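/- Let $1<\alpha<2$, let $d\in\mathbb N$ with $d>\alpha$, and let $|\cdot|$ be the Euclidean norm. Let $\{w_{x,y}\}$, indexed by the unordered pairs of distinct points $x\neq y$ of $\mathbb Z^d$ (so $w_{x,y}=w_{y,x}$), be i.i.d. non-negative random variables on a probability space $(\Omega,\mathcal F,\mathbb P)$ with $\mathbb E[w_{x,y}]=1$ and $w_{x,y}\le C_1$ for some constant $C_1>0$. For $m\in\mathbb N$ put $B_{2^m}=(-2^m,2^m]^d\cap\mathbb Z^d$, and for $f:B_{2^m}\to\mathbb R^d$ put $$\mathcal L_{B_{2^m}}f(x)=\sum_{y\in B_{2^m},\,y\ne x}(f(y)-f(x))\frac{w_{x,y}}{|x-y|^{d+\alpha}},\qquad \mathscr E_{B_{2^m}}(f,f)=\frac12\sum_{i=1}^d\sum_{x,y\in B_{2^m},\,x\neq y}\bigl(f^{(i)}(x)-f^{(i)}(y)\bigr)^2\frac{w_{x,y}}{|x-y|^{d+\alpha}}.$$ Let $V(x)=\sum_{z\in\mathbb Z^d\setminus\{0\}}\frac{z}{|z|^{d+\alpha}}\,w_{x,x+z}$ for $x\in\mathbb Z^d$. Then for every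 $\gamma>0$ there exist a (deterministic) constant $C_3>0$ and a random variable $m_1^*\ge 1$ such that, almost surely, for every integer $m>m_1^*(\omega)$ the local Poisson equation $$\mathcal L_{B_{2^m}}\phi_m(x)=-V(x)+\frac{1}{|B_{2^m}|}\sum_{y\in B_{2^m}}V(y)\quad (x\in B_{2^m}),\qquad \sum_{x\in B_{2^m}}\phi_m(x)=0,$$ has a unique solution $\phi_m:B_{2^m}\to\mathbb R^d$, and $$\mathscr E_{B_{2^m}}(\phi_m,\phi_m)\le C_3\,m^{\frac{(1+\gamma)\alpha}{(2(d-\alpha))\wedge d}}\,2^{md}.$$ -/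

import Mathlib

open MeasureTheory ProbabilityTheory

noncomputable section

namespace StableConductance

/-- The integer lattice `ℤ^d`. -/
abbrev Lattice (d : ℕ) : Type := Fin d → ℤ

/-- The inclusion of `ℤ^d` into Euclidean space `ℝ^d`. -/
def toEuclidean {d : ℕ} (z : Lattice d) : EuclideanSpace ℝ (Fin d) :=
  WithLp.toLp 2 (fun i => (z i : ℝ))

/-- The cube `(-R, R]^d ∩ ℤ^d`. -/
def box (d : ℕ) (R : ℤ) : Finset (Lattice d) :=
  Fintype.piFinset (fun _ => Finset.Ioc (-R) R)

/-- The jump kernel `w_{x,y} / |x - y|^{d+α}` for the conductances `w`, which are attached to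
unordered pairs (the values of `w` on the diagonal are irrelevant below). -/
def kernel {d : ℕ} (α : ℝ) (w : Sym2 (Lattice d) → ℝ) (x y : Lattice d) : ℝ :=
  w s(x, y) / ‖toEuclidean (x - y)‖ ^ ((d : ℝ) + α)

/-- The mean of a vector-valued function over a finite set `U`. -/
def mean {d : ℕ} (U : Finset (Lattice d)) (f : Lattice d → EuclideanSpace ℝ (Fin d)) :
    EuclideanSpace ℝ (Fin d) :=
  (U.card : ℝ)⁻¹ • ∑ x ∈ U, f x

/-- The operator `L_U f (x) = ∑_{y ∈ U, y ≠ x} (f y - f x) w_{x,y} / |x - y|^{d+α}` on functions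
on the finite set `U`. -/
def localGenerator {d : ℕ} (α : ℝ) (w : Sym2 (Lattice d) → ℝ) (U : Finset (Lattice d))
    (f : U → EuclideanSpace ℝ (Fin d)) (x : U) : EuclideanSpace ℝ (Fin d) :=
  ∑ y ∈ Finset.univ.erase x, kernel α w x y • (f y - f x)

/-- The energy `E_U(f, f) = 1/2 ∑_i ∑_{x ≠ y in U} (f_i x - f_i y)^2 w_{x,y} / |x - y|^{d+α}`. -/
def localEnergy {d : ℕ} (α : ℝ) (w : Sym2 (Lattice d) → ℝ) (U : Finset (Lattice d))
    (f : U → EuclideanSpace ℝ (Fin d)) : ℝ :=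
  1 / 2 * ∑ i : Fin d, ∑ x : U, ∑ y ∈ Finset.univ.erase x,
    (f x i - f y i) ^ 2 * kernel α w x y

/-- The drift `V(x) = ∑_{z ∈ ℤ^d} (z / |z|^{d+α}) w_{x,x+z}`; the term `z = 0` is zero.
For bounded `w` and `α > 1` the series converges absolutely. -/
def drift {d : ℕ} (α : ℝ) (w : Sym2 (Lattice d) → ℝ) (x : Lattice d) :
    EuclideanSpace ℝ (Fin d) :=
  ∑' z : Lattice d, (w s(x, x + z) / ‖toEuclidean z‖ ^ ((d : ℝ) + α)) • toEuclidean z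

/-- `φ` solves the local Poisson equation on `U`:
`L_U φ = -V + mean_U V` on `U` and `∑_{x ∈ U} φ x = 0`. -/
def IsLocalCorrector {d : ℕ} (α : ℝ) (w : Sym2 (Lattice d) → ℝ) (U : Finset (Lattice d))
    (φ : U → EuclideanSpace ℝ (Fin d)) : Prop :=
  (∀ x : U, localGenerator α w U φ x = -drift α w x + mean U (drift α w)) ∧ ∑ x : U, φ x = 0

/-- The unordered pairs of distinct lattice points. -/
abbrev Edge (d : ℕ) : Type := {e : Sym2 (Lattice d) // ¬ e.IsDiag}

/-- The standing assumption on the random conductances: over the unordered pairs of distinct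
points they are i.i.d., non-negative, of mean one, and bounded by a constant. -/
structure IIDConductances {d : ℕ} {Ω : Type*} [MeasurableSpace Ω] (P : Measure Ω)
    (w : Sym2 (Lattice d) → Ω → ℝ) : Prop where
  measurable : ∀ e : Edge d, Measurable (w e)
  indep : iIndepFun (fun e : Edge d => w e) P
  ident : ∀ e e' : Edge d, IdentDistrib (w e) (w e') P P
  nonneg : ∀ e : Edge d, ∀ᵐ ω ∂P, 0 ≤ w e ω
  mean_one : ∀ e : Edge d, ∫ ω, w e ω ∂P = 1
  bounded : ∃ C : ℝ, 0 < C ∧ ∀ e : Edge d, ∀ᵐ ω ∂P, w e ω ≤ C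

end StableConductance

end

/-! Each coordinate of the corrector is treated separately. Testing the equation against a
coordinate `φ` of mean zero removes the mean of `V`, so the energy `e` of `φ` equals the pairing `∑
V φ`. It remains to bound this pairing by `√e`, which is done by telescoping `φ` through its
averages over dyadic cells of side `2^n`, from a starting scale `n₀` up to the whole cube, where the
average is zero (`dirichlet_le_of_multiscale`).

Two estimates enter. A Poincaré inequality bounds the squared deviation of `φ` from its cell
averages by a constant times `2^(αn) e`; it comes from averaging over two-step paths `x, z, y`
inside a cell, of which there are enough with high probability (`sum_cell_sq_sub_le`,
`measureReal_path_lt_le`). And the drift is centred, because its coefficients are odd, so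
Hoeffding's inequality bounds its sum over a cell by a multiple of `√(m 2^(nd))`
(`measureReal_drift_ge_le`, `abs_sum_block_drift_le`). The increment between scales `n` and `n + 1`
is constant on cells of side `2^n`, so it sees only these cell sums and contributes a multiple of
`√(2^(md) e) √m 2^((α-d)n/2)`. Since `α < d` the series is geometric and its first term dominates.

Union bounds over the cube succeed once `2^(d n₀)` is a large multiple of `m`. With `n₀` minimal
this gives energy at most a constant times `2^(α n₀) 2^(md)`, hence `m^(α/d) 2^(md)`; the exponent
`α/d` is at most the stated one because the minimum there is at most `d`. Borel–Cantelli finishes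
the argument. Solvability also follows from the Poincaré inequality on the whole cube, which forces
functions of zero energy to be constant. -/

namespace StableConductance

/-! ### Block averages, block Poincaré inequality and the multiscale energy bound. -/

section Multiscale

variable {X K : Type*} [Fintype X] [DecidableEq K]

/-- The (scalar) Dirichlet form of the symmetric kernel `k`. -/
noncomputable def dirichlet (k : X → X → ℝ) (f : X → ℝ) : ℝ :=
  1 / 2 * ∑ x, ∑ y, (f x - f y) ^ 2 * k x y

/-- The average of `f` over the block of `x`, the blocks being the fibres of `c`. -/
noncomputable def blockAvg (c : X → K) (f : X → ℝ) (x : X) : ℝ :=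
  (∑ y with c y = c x, f y) / (Finset.univ.filter fun y => c y = c x).card

lemma dirichlet_nonneg {k : X → X → ℝ} (hk : ∀ x y, 0 ≤ k x y) (f : X → ℝ) :
    0 ≤ dirichlet k f :=
  mul_nonneg (by norm_num) <| Finset.sum_nonneg fun x _ => Finset.sum_nonneg fun y _ =>
    mul_nonneg (sq_nonneg _) (hk x y)

lemma blockAvg_congr (c : X → K) (f : X → ℝ) {x y : X} (h : c x = c y) :
    blockAvg c f x = blockAvg c f y := by
  simp only [blockAvg, h]

/-- Summation over blocks in either order. -/
lemma sum_block_comm (c : X → K) (F : X → X → ℝ) :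
    ∑ x, ∑ y with c y = c x, F x y = ∑ y, ∑ x with c x = c y, F x y := by
  simp only [Finset.sum_filter]
  rw [Finset.sum_comm]
  simp only [eq_comm]

lemma card_block_pos (c : X → K) (x : X) :
    0 < (Finset.univ.filter fun y => c y = c x).card :=
  Finset.card_pos.mpr ⟨x, by simp⟩

/-- The deviation from the block average is the average of the differences `f x - f y` over the
block; then Cauchy–Schwarz. -/
lemma sum_sq_sub_blockAvg_le (c : X → K) {N : ℕ}
    (hN : ∀ x, (Finset.univ.filter fun y => c y = c x).card = N) (f : X → ℝ) :
    ∑ x, (f x - blockAvg c f x) ^ 2 ≤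
      (N : ℝ)⁻¹ * ∑ x, ∑ y with c y = c x, (f x - f y) ^ 2 := by
  rw [Finset.mul_sum]
  refine Finset.sum_le_sum fun x _ => ?_
  have hNpos : (0 : ℝ) < N := by exact_mod_cast (hN x) ▸ card_block_pos c x
  have h1 : f x - blockAvg c f x = (N : ℝ)⁻¹ * ∑ y with c y = c x, (f x - f y) := by
    rw [Finset.sum_sub_distrib, Finset.sum_const, blockAvg, hN x, nsmul_eq_mul]
    field_simp
  have h2 := sq_sum_le_card_mul_sum_sq (s := Finset.univ.filter fun y => c y = c x)
    (f := fun y => f x - f y)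
  rw [hN x] at h2
  rw [h1, mul_pow]
  calc (N : ℝ)⁻¹ ^ 2 * (∑ y with c y = c x, (f x - f y)) ^ 2
      ≤ (N : ℝ)⁻¹ ^ 2 * (N * ∑ y with c y = c x, (f x - f y) ^ 2) := by gcongr
    _ = _ := by field_simp

/-- Pairing a function whose block sums are small with a function constant on blocks. -/
lemma abs_sum_mul_le_of_block (c : X → K) {N : ℕ}
    (hN : ∀ x, (Finset.univ.filter fun y => c y = c x).card = N) {V g : X → ℝ} {v : ℝ}
    (hV : ∀ x, |∑ y with c y = c x, V y| ≤ N * v) (hg : ∀ x y, c x = c y → g x = g y) :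
    |∑ x, V x * g x| ≤ v * ∑ x, |g x| := by
  rcases isEmpty_or_nonempty X with hX | ⟨⟨x₀⟩⟩
  · simp
  have hNpos : (0 : ℝ) < N := by exact_mod_cast (hN x₀) ▸ card_block_pos c x₀
  have h1 : (N : ℝ) * ∑ x, V x * g x = ∑ x, g x * ∑ y with c y = c x, V y := by
    calc (N : ℝ) * ∑ x, V x * g x = ∑ y, ∑ x with c x = c y, V y * g y := by
          rw [Finset.mul_sum]
          refine Finset.sum_congr rfl fun y _ => ?_
          rw [Finset.sum_const, hN y, nsmul_eq_mul]
      _ = ∑ x, ∑ y with c y = c x, V y * g y := (sum_block_comm c fun _ y => V y * g y).symm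
      _ = _ := by
          refine Finset.sum_congr rfl fun x _ => ?_
          rw [Finset.mul_sum]
          refine Finset.sum_congr rfl fun y hy => ?_
          rw [hg y x (Finset.mem_filter.mp hy).2, mul_comm]
  have h2 : (N : ℝ) * |∑ x, V x * g x| ≤ N * (v * ∑ x, |g x|) := by
    rw [← abs_of_pos hNpos, ← abs_mul, abs_of_pos hNpos, h1]
    refine (Finset.abs_sum_le_sum_abs _ _).trans ?_
    rw [Finset.mul_sum, Finset.mul_sum]
    refine Finset.sum_le_sum fun x _ => ?_
    rw [abs_mul]
    calc |g x| * |∑ y with c y = c x, V y| ≤ |g x| * (N * v) := by gcongr; exact hV x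
      _ = _ := by ring
  exact le_of_mul_le_mul_left h2 hNpos

lemma sum_abs_le_sqrt (g : X → ℝ) :
    ∑ x, |g x| ≤ √(Fintype.card X) * √(∑ x, g x ^ 2) := by
  rw [← Real.sqrt_mul (by positivity)]
  refine Real.le_sqrt_of_sq_le ?_
  have := sq_sum_le_card_mul_sum_sq (s := (Finset.univ : Finset X)) (f := fun x => |g x|)
  simpa [sq_abs] using this

/-- The Poincaré inequality on blocks, from many two-step paths inside each block. -/
lemma sum_block_sq_sub_le (c : X → K) {N : ℕ}
    (hN : ∀ x, (Finset.univ.filter fun y => c y = c x).card = N)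
    {W k : X → X → ℝ} {C ρ : ℝ} (hρ : 0 ≤ ρ)
    (hW0 : ∀ x y, 0 ≤ W x y) (hWC : ∀ x y, W x y ≤ C) (hk : ∀ x y, 0 ≤ k x y)
    (hWk : ∀ x y, c y = c x → W x y ≤ ρ * k x y)
    (hpath : ∀ x y, x ≠ y → c y = c x → (N : ℝ) / 4 ≤ ∑ z with c z = c x, W x z * W y z)
    (f : X → ℝ) :
    ∑ x, ∑ y with c y = c x, (f x - f y) ^ 2 ≤ 32 * C * ρ * dirichlet k f := by
  rcases isEmpty_or_nonempty X with hX | ⟨⟨x₀⟩⟩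
  · simp [dirichlet]
  have hNpos : (0 : ℝ) < N := by exact_mod_cast (hN x₀) ▸ card_block_pos c x₀
  have hC : 0 ≤ C := (hW0 x₀ x₀).trans (hWC x₀ x₀)
  set J : ℝ := ∑ x, ∑ z with c z = c x, (f x - f z) ^ 2 * W x z with hJ
  have hJk : J ≤ 2 * ρ * dirichlet k f := by
    calc J ≤ ∑ x, ∑ z, (f x - f z) ^ 2 * (ρ * k x z) := by
          refine Finset.sum_le_sum fun x _ => ?_
          refine (Finset.sum_le_sum (g := fun z => (f x - f z) ^ 2 * (ρ * k x z))
            fun z hz => ?_).trans ?_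
          · exact mul_le_mul_of_nonneg_left (hWk x z (Finset.mem_filter.mp hz).2) (sq_nonneg _)
          · exact Finset.sum_le_sum_of_subset_of_nonneg (Finset.filter_subset _ _)
              fun z _ _ => mul_nonneg (sq_nonneg _) (mul_nonneg hρ (hk x z))
      _ = _ := by
          simp only [dirichlet, Finset.mul_sum]
          refine Finset.sum_congr rfl fun x _ => Finset.sum_congr rfl fun z _ => ?_
          ring
  -- Average over midpoints `z` with weight `W x z * W y z`, of total mass at least `N / 4`. After
  -- splitting the difference at `z`, the weight not on the retained edge is bounded by `C`.
  have hpair : ∀ x y, c y = c x → (f x - f y) ^ 2 * (N / 4) ≤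
      ∑ z with c z = c x, 2 * C * ((f x - f z) ^ 2 * W x z + (f y - f z) ^ 2 * W y z) := by
    intro x y hxy
    rcases eq_or_ne x y with rfl | hne
    · simp only [sub_self, ne_eq, OfNat.ofNat_ne_zero, not_false_eq_true, zero_pow, zero_mul]
      exact Finset.sum_nonneg fun z _ => by
        have := hW0 x z
        positivity
    calc (f x - f y) ^ 2 * (N / 4)
        ≤ (f x - f y) ^ 2 * ∑ z with c z = c x, W x z * W y z := by
          gcongr
          exact hpath x y hne hxy
      _ = ∑ z with c z = c x, (f x - f y) ^ 2 * (W x z * W y z) := by rw [Finset.mul_sum]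
      _ ≤ _ := by
          refine Finset.sum_le_sum fun z _ => ?_
          have e : (f x - f y) ^ 2 ≤ 2 * (f x - f z) ^ 2 + 2 * (f y - f z) ^ 2 := by
            nlinarith [sq_nonneg (f x - f z + (f y - f z))]
          have hx := hW0 x z
          have hy := hW0 y z
          calc (f x - f y) ^ 2 * (W x z * W y z)
              ≤ (2 * (f x - f z) ^ 2 + 2 * (f y - f z) ^ 2) * (W x z * W y z) := by gcongr
            _ = 2 * ((f x - f z) ^ 2 * W x z * W y z + (f y - f z) ^ 2 * W y z * W x z) := by ring
            _ ≤ 2 * ((f x - f z) ^ 2 * W x z * C + (f y - f z) ^ 2 * W y z * C) := by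
                gcongr
                · exact hWC y z
                · exact hWC x z
            _ = _ := by ring
  have hsum : (∑ x, ∑ y with c y = c x, (f x - f y) ^ 2) * (N / 4) ≤ 4 * C * N * J := by
    calc (∑ x, ∑ y with c y = c x, (f x - f y) ^ 2) * (N / 4)
        = ∑ x, ∑ y with c y = c x, (f x - f y) ^ 2 * (N / 4) := by
          simp only [Finset.sum_mul]
      _ ≤ ∑ x, ∑ y with c y = c x, ∑ z with c z = c x,
            2 * C * ((f x - f z) ^ 2 * W x z + (f y - f z) ^ 2 * W y z) :=
          Finset.sum_le_sum fun x _ => Finset.sum_le_sum fun y hy =>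
            hpair x y (Finset.mem_filter.mp hy).2
      _ = 2 * C * (∑ x, ∑ y with c y = c x, ∑ z with c z = c x, (f x - f z) ^ 2 * W x z) +
          2 * C * (∑ x, ∑ y with c y = c x, ∑ z with c z = c x, (f y - f z) ^ 2 * W y z) := by
          simp only [mul_add, Finset.sum_add_distrib, Finset.mul_sum]
      _ = 2 * C * (N * J) + 2 * C * (N * J) := by
          have e1 : ∑ x, ∑ y with c y = c x, ∑ z with c z = c x, (f x - f z) ^ 2 * W x z
              = N * J := by
            rw [hJ, Finset.mul_sum]
            refine Finset.sum_congr rfl fun x _ => ?_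
            rw [Finset.sum_const, hN x, nsmul_eq_mul]
          have e2 : ∑ x, ∑ y with c y = c x, ∑ z with c z = c x, (f y - f z) ^ 2 * W y z
              = N * J := by
            rw [sum_block_comm c fun x y => ∑ z with c z = c x, (f y - f z) ^ 2 * W y z, ← e1]
            refine Finset.sum_congr rfl fun x _ => Finset.sum_congr rfl fun y hy => ?_
            rw [(Finset.mem_filter.mp hy).2]
          rw [e1, e2]
      _ = _ := by ring
  have h3 : (N : ℝ) * ∑ x, ∑ y with c y = c x, (f x - f y) ^ 2 ≤
      N * (32 * C * ρ * dirichlet k f) := by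
    have := mul_le_mul_of_nonneg_left hJk (by positivity : 0 ≤ 16 * C * N)
    nlinarith
  exact le_of_mul_le_mul_left h3 hNpos

/-- The multiscale bound: a function `φ` of zero mean whose energy is its pairing with `V` has
small energy if `V` has small averages over the blocks at all scales from `n₀` on. -/
theorem dirichlet_le_of_multiscale {c : ℕ → X → K} {N : ℕ → ℕ} {n₀ M : ℕ} (hn₀ : n₀ ≤ M)
    (hN : ∀ n x, n ≤ M → (Finset.univ.filter fun y => c n y = c n x).card = N n)
    (hc : ∀ n x y, c n x = c n y → c (n + 1) x = c (n + 1) y) (htop : ∀ x y, c M x = c M y)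
    {k : X → X → ℝ} (hk : ∀ x y, 0 ≤ k x y) {D v : ℕ → ℝ} (hD : Monotone D) (hD0 : ∀ n, 0 ≤ D n)
    (hv0 : ∀ n, 0 ≤ v n) {C₀ : ℝ} {V φ : X → ℝ} (hV : ∀ x, |V x| ≤ C₀)
    (hVblock : ∀ n, n₀ ≤ n → n < M → ∀ x, |∑ y with c n y = c n x, V y| ≤ N n * v n)
    (hpoin : ∀ n, n₀ ≤ n → n ≤ M →
      ∑ x, ∑ y with c n y = c n x, (φ x - φ y) ^ 2 ≤ N n * (D n * dirichlet k φ))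
    (hφ : ∑ x, φ x = 0) (henergy : dirichlet k φ = ∑ x, V x * φ x) :
    dirichlet k φ ≤ Fintype.card X *
      (C₀ * √(D n₀) + 2 * ∑ n ∈ Finset.Ico n₀ M, v n * √(D (n + 1))) ^ 2 := by
  rcases isEmpty_or_nonempty X with hX | ⟨⟨x₀⟩⟩
  · simp [dirichlet]
  have hC₀ : 0 ≤ C₀ := (abs_nonneg _).trans (hV x₀)
  set e := dirichlet k φ with he
  have he0 : 0 ≤ e := dirichlet_nonneg hk φ
  let A : ℕ → X → ℝ := fun n => blockAvg (c n) φ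
  have hdev : ∀ n, n₀ ≤ n → n ≤ M → ∑ x, (φ x - A n x) ^ 2 ≤ D n * e := by
    intro n h1 h2
    refine (sum_sq_sub_blockAvg_le (c n) (fun x => hN n x h2) φ).trans ?_
    have hNpos : (0 : ℝ) < N n := by exact_mod_cast (hN n x₀ h2) ▸ card_block_pos (c n) x₀
    rw [inv_mul_le_iff₀ hNpos]
    exact hpoin n h1 h2
  have hfirst : |∑ x, V x * (φ x - A n₀ x)| ≤
      √(Fintype.card X) * √e * (C₀ * √(D n₀)) := by
    calc |∑ x, V x * (φ x - A n₀ x)| ≤ ∑ x, C₀ * |φ x - A n₀ x| := by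
          refine (Finset.abs_sum_le_sum_abs _ _).trans (Finset.sum_le_sum fun x _ => ?_)
          rw [abs_mul]
          gcongr
          exact hV x
      _ = C₀ * ∑ x, |φ x - A n₀ x| := by rw [Finset.mul_sum]
      _ ≤ C₀ * (√(Fintype.card X) * √(∑ x, (φ x - A n₀ x) ^ 2)) := by
          gcongr
          exact sum_abs_le_sqrt _
      _ ≤ C₀ * (√(Fintype.card X) * √(D n₀ * e)) := by
          gcongr
          exact hdev n₀ le_rfl hn₀
      _ = _ := by rw [Real.sqrt_mul (hD0 _)]; ring
  have hstep : ∀ n ∈ Finset.Ico n₀ M, |∑ x, V x * (A n x - A (n + 1) x)| ≤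
      √(Fintype.card X) * √e * (2 * (v n * √(D (n + 1)))) := by
    intro n hn
    obtain ⟨h1, h2⟩ := Finset.mem_Ico.mp hn
    -- Both averages are compared with `φ`; monotonicity of `D` puts both errors at scale `n + 1`.
    have hsq : ∑ x, (A n x - A (n + 1) x) ^ 2 ≤ 2 ^ 2 * (D (n + 1) * e) := by
      calc ∑ x, (A n x - A (n + 1) x) ^ 2
          ≤ ∑ x, (2 * (φ x - A n x) ^ 2 + 2 * (φ x - A (n + 1) x) ^ 2) := by
            refine Finset.sum_le_sum fun x _ => ?_
            nlinarith [sq_nonneg ((φ x - A n x) + (φ x - A (n + 1) x))]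
        _ = 2 * ∑ x, (φ x - A n x) ^ 2 + 2 * ∑ x, (φ x - A (n + 1) x) ^ 2 := by
            rw [Finset.sum_add_distrib, Finset.mul_sum, Finset.mul_sum]
        _ ≤ 2 * (D (n + 1) * e) + 2 * (D (n + 1) * e) := by
            gcongr
            · refine (hdev n h1 h2.le).trans ?_
              gcongr
              exact hD (Nat.le_succ n)
            · exact hdev (n + 1) (by omega) (by omega)
        _ = _ := by ring
    -- The increment is constant on the blocks of scale `n` because these refine those of scale `n +
    -- 1`.
    calc |∑ x, V x * (A n x - A (n + 1) x)| ≤ v n * ∑ x, |A n x - A (n + 1) x| :=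
          abs_sum_mul_le_of_block (c n) (fun x => hN n x h2.le) (hVblock n h1 h2) fun x y hxy => by
            simp only [A, blockAvg_congr (c n) φ hxy, blockAvg_congr (c (n + 1)) φ (hc n x y hxy)]
      _ ≤ v n * (√(Fintype.card X) * √(∑ x, (A n x - A (n + 1) x) ^ 2)) := by
          gcongr
          · exact hv0 n
          · exact sum_abs_le_sqrt _
      _ ≤ v n * (√(Fintype.card X) * √(2 ^ 2 * (D (n + 1) * e))) := by
          gcongr
          exact hv0 n
      _ = _ := by
          rw [Real.sqrt_mul (by norm_num), Real.sqrt_mul (hD0 _), Real.sqrt_sq (by norm_num)]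
          ring
  have htopzero : ∀ x, A M x = 0 := by
    intro x
    have : (Finset.univ.filter fun y => c M y = c M x) = Finset.univ :=
      Finset.filter_true_of_mem fun y _ => htop y x
    simp [A, blockAvg, this, hφ]
  have htel : ∀ x, φ x = (φ x - A n₀ x) + ∑ n ∈ Finset.Ico n₀ M, (A n x - A (n + 1) x) := by
    intro x
    have : ∑ n ∈ Finset.Ico n₀ M, (A n x - A (n + 1) x) = A n₀ x - A M x := by
      have := Finset.sum_Ico_sub (fun n => A n x) hn₀
      rw [← neg_sub, ← this, ← Finset.sum_neg_distrib]
      simp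
    rw [this, htopzero]
    ring
  set S := C₀ * √(D n₀) + 2 * ∑ n ∈ Finset.Ico n₀ M, v n * √(D (n + 1)) with hS
  have hS0 : 0 ≤ S := by
    have : 0 ≤ ∑ n ∈ Finset.Ico n₀ M, v n * √(D (n + 1)) :=
      Finset.sum_nonneg fun n _ => mul_nonneg (hv0 n) (Real.sqrt_nonneg _)
    positivity
  have hmain : e ≤ √(Fintype.card X) * √e * S := by
    calc e = ∑ x, V x * φ x := henergy
      _ = ∑ x, V x * (φ x - A n₀ x) +
          ∑ n ∈ Finset.Ico n₀ M, ∑ x, V x * (A n x - A (n + 1) x) := by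
          rw [Finset.sum_comm, ← Finset.sum_add_distrib]
          refine Finset.sum_congr rfl fun x _ => ?_
          rw [← Finset.mul_sum, ← mul_add, ← htel x]
      _ ≤ √(Fintype.card X) * √e * (C₀ * √(D n₀)) +
          ∑ n ∈ Finset.Ico n₀ M, √(Fintype.card X) * √e * (2 * (v n * √(D (n + 1)))) := by
          refine add_le_add ((le_abs_self _).trans hfirst) (Finset.sum_le_sum fun n hn => ?_)
          exact (le_abs_self _).trans (hstep n hn)
      _ = _ := by
          rw [← Finset.mul_sum, ← Finset.mul_sum, hS]
          ring
  have hsq : √e * √e ≤ (√(Fintype.card X) * S) * √e := by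
    rw [Real.mul_self_sqrt he0]
    linarith
  have hroot : √e ≤ √(Fintype.card X) * S := by
    rcases (Real.sqrt_nonneg e).eq_or_lt with h0 | h0
    · rw [← h0]; positivity
    · exact le_of_mul_le_mul_right hsq h0
  calc e = √e ^ 2 := (Real.sq_sqrt he0).symm
    _ ≤ (√(Fintype.card X) * S) ^ 2 := by gcongr
    _ = _ := by rw [mul_pow, Real.sq_sqrt (by positivity)]

end Multiscale

/-! ### The Poisson equation on a finite network. -/

section Poisson

variable {X : Type*} [Fintype X] {k : X → X → ℝ}

lemma sum_generator_eq_zero (hsymm : ∀ x y, k x y = k y x) (f : X → ℝ) :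
    ∑ x, ∑ y, k x y * (f y - f x) = 0 := by
  have h : ∑ x, ∑ y, k x y * (f y - f x) = -∑ x, ∑ y, k x y * (f y - f x) := by
    conv_lhs => rw [Finset.sum_comm]
    rw [← Finset.sum_neg_distrib]
    refine Finset.sum_congr rfl fun x _ => ?_
    rw [← Finset.sum_neg_distrib]
    refine Finset.sum_congr rfl fun y _ => ?_
    rw [hsymm y x]
    ring
  linarith

/-- Summation by parts: exchanging `x` and `y` and adding the two copies of the pairing produces the
square. -/
lemma dirichlet_eq_neg_sum (hsymm : ∀ x y, k x y = k y x) (f : X → ℝ) :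
    dirichlet k f = -∑ x, (∑ y, k x y * (f y - f x)) * f x := by
  have h : ∑ x, (∑ y, k x y * (f y - f x)) * f x = ∑ x, ∑ y, k x y * (f x - f y) * f y := by
    simp only [Finset.sum_mul]
    rw [Finset.sum_comm]
    refine Finset.sum_congr rfl fun x _ => Finset.sum_congr rfl fun y _ => ?_
    rw [hsymm y x]
  have h2 : 2 * ∑ x, (∑ y, k x y * (f y - f x)) * f x = -∑ x, ∑ y, (f x - f y) ^ 2 * k x y := by
    rw [two_mul]
    nth_rewrite 2 [h]
    rw [← Finset.sum_add_distrib, ← Finset.sum_neg_distrib]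
    refine Finset.sum_congr rfl fun x _ => ?_
    rw [Finset.sum_mul, ← Finset.sum_add_distrib, ← Finset.sum_neg_distrib]
    refine Finset.sum_congr rfl fun y _ => ?_
    ring
  rw [dirichlet]
  linarith

/-- Solvability of the Poisson equation on a finite irreducible network. -/
theorem existsUnique_poisson [Nonempty X] (hsymm : ∀ x y, k x y = k y x)
    (hirr : ∀ f : X → ℝ, dirichlet k f = 0 → ∀ x y, f x = f y) {g : X → ℝ} (hg : ∑ x, g x = 0) :
    ∃! f : X → ℝ, (∀ x, ∑ y, k x y * (f y - f x) = g x) ∧ ∑ x, f x = 0 := by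
  have hcard : (Fintype.card X : ℝ) ≠ 0 := by exact_mod_cast Fintype.card_ne_zero
  have hker : ∀ f : X → ℝ, (∀ x, ∑ y, k x y * (f y - f x) = 0) → ∑ x, f x = 0 → f = 0 := by
    intro f hf hs
    have h0 : dirichlet k f = 0 := by
      rw [dirichlet_eq_neg_sum hsymm]
      simp [hf]
    funext x
    have : ∑ y, f y = Fintype.card X * f x := by
      rw [Finset.sum_congr rfl fun y _ => hirr f h0 y x]
      simp
    rw [hs] at this
    simpa [hcard] using this.symm
  -- Adding the total mass removes the constants from the kernel. Summing `T f = g` over all points,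
  -- with `∑ g = 0`, shows that the added term vanishes, so `T f = g` encodes both conditions.
  let T : (X → ℝ) →ₗ[ℝ] (X → ℝ) :=
    { toFun := fun f x => ∑ y, k x y * (f y - f x) + ∑ y, f y
      map_add' := fun f f' => by
        funext x
        simp only [Pi.add_apply, Finset.sum_add_distrib]
        have : ∀ y, k x y * (f y + f' y - (f x + f' x)) =
            k x y * (f y - f x) + k x y * (f' y - f' x) := fun y => by ring
        simp only [this, Finset.sum_add_distrib]
        ring
      map_smul' := fun a f => by
        funext x
        simp only [Pi.smul_apply, smul_eq_mul, RingHom.id_apply, mul_add, Finset.mul_sum]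
        congr 1
        exact Finset.sum_congr rfl fun y _ => by ring }
  have hTsum : ∀ f, ∑ x, T f x = Fintype.card X * ∑ x, f x := by
    intro f
    simp only [T, LinearMap.coe_mk, AddHom.coe_mk, Finset.sum_add_distrib,
      sum_generator_eq_zero hsymm f, zero_add, Finset.sum_const, Finset.card_univ, nsmul_eq_mul]
  have hinj : Function.Injective T := by
    rw [← LinearMap.ker_eq_bot, LinearMap.ker_eq_bot']
    intro f hf
    have hs : ∑ x, f x = 0 := by
      have := hTsum f
      rw [hf] at this
      simpa [hcard] using this.symm
    refine hker f (fun x => ?_) hs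
    have := congrFun hf x
    simpa [T, hs] using this
  obtain ⟨f, hf⟩ := LinearMap.surjective_of_injective hinj g
  have hs : ∑ x, f x = 0 := by
    have := hTsum f
    rw [hf, hg] at this
    simpa [hcard] using this.symm
  refine ⟨f, ⟨fun x => ?_, hs⟩, fun f' hf' => ?_⟩
  · have := congrFun hf x
    simpa [T, hs] using this
  · refine hinj (Eq.trans ?_ hf.symm)
    funext x
    simp [T, hf'.1 x, hf'.2]

end Poisson

/-! ### Sub-Gaussian bounds for the two statistics of the conductances. -/

section Concentration

open scoped NNReal

variable {Ω : Type*} [MeasurableSpace Ω] {P : Measure Ω}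

lemma hasSubgaussianMGF_mono {Y : Ω → ℝ} {c c' : ℝ≥0} (h : HasSubgaussianMGF Y c P)
    (hc : c ≤ c') : HasSubgaussianMGF Y c' P :=
  ⟨h.integrable_exp_mul, fun t => (h.mgf_le t).trans <| Real.exp_le_exp.mpr <| by
    have : (c : ℝ) ≤ c' := hc
    gcongr⟩

variable [IsProbabilityMeasure P] {ι τ : Type*} {f : ι → Ω → ℝ} {C : ℝ}

/-- Hoeffding's inequality for a weighted sum of distinct members of an independent family of
random variables with values in `[0, C]` and mean one. -/
theorem measureReal_abs_weighted_sum_ge_le (hf : iIndepFun f P) (hm : ∀ i, Measurable (f i))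
    (hb : ∀ i, ∀ᵐ ω ∂P, f i ω ∈ Set.Icc 0 C) (h1 : ∀ i, ∫ ω, f i ω ∂P = 1) {s : Finset τ}
    {g : τ → ι} (hg : Set.InjOn g s) (a : τ → ℝ) {S : ℝ} (hS : ∑ t ∈ s, a t ^ 2 ≤ S) {ε : ℝ}
    (hε : 0 ≤ ε) :
    P.real {ω | ε ≤ |∑ t ∈ s, a t * (f (g t) ω - 1)|} ≤ 2 * Real.exp (-ε ^ 2 / (S * C ^ 2)) := by
  have hS0 : 0 ≤ S := (Finset.sum_nonneg fun t _ => sq_nonneg (a t)).trans hS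
  have hsub : ∀ i, HasSubgaussianMGF (fun ω => f i ω - 1) ((‖C - 0‖₊ / 2) ^ 2) P := fun i => by
    simpa only [h1 i] using hasSubgaussianMGF_of_mem_Icc (hm i).aemeasurable (hb i)
  have hind : iIndepFun (fun (t : s) ω => a t * (f (g t) ω - 1)) P := by
    have hinj : Function.Injective fun t : s => g t := fun t t' h =>
      Subtype.ext (hg t.2 t'.2 h)
    exact (hf.precomp hinj).comp (fun t u => a t * (u - 1)) fun t => by fun_prop
  have hsum := HasSubgaussianMGF.sum_of_iIndepFun hind (s := Finset.univ)
    fun t _ => (hsub (g t)).const_mul (a t)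
  -- The actual variance proxy is at most `S * C ^ 2 / 4`; doubling it gives a cleaner exponent.
  have hsum' := hasSubgaussianMGF_mono hsum (c' := (S * C ^ 2 / 2).toNNReal) <| by
    rw [← NNReal.coe_le_coe, Real.coe_toNNReal _ (by positivity)]
    rw [NNReal.coe_sum]
    change ∑ t : s, a t ^ 2 * (‖C - 0‖ / 2) ^ 2 ≤ _
    have : ∑ t : s, a t ^ 2 = ∑ t ∈ s, a t ^ 2 := Finset.sum_coe_sort s fun t => a t ^ 2
    rw [← Finset.sum_mul, sub_zero]
    rw [this, div_pow, Real.norm_eq_abs, sq_abs]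
    nlinarith [mul_le_mul_of_nonneg_right hS (sq_nonneg C), mul_nonneg hS0 (sq_nonneg C)]
  have heq : ∀ ω, ∑ t : s, a t * (f (g t) ω - 1) = ∑ t ∈ s, a t * (f (g t) ω - 1) := fun ω =>
    Finset.sum_coe_sort s fun t => a t * (f (g t) ω - 1)
  simp only [heq] at hsum'
  have hup := hsum'.measure_ge_le hε
  have hdown := hsum'.neg.measure_ge_le hε
  have hconst : 2 * ((S * C ^ 2 / 2).toNNReal : ℝ) = S * C ^ 2 := by
    rw [Real.coe_toNNReal _ (by positivity)]
    ring
  rw [hconst] at hup hdown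
  calc P.real {ω | ε ≤ |∑ t ∈ s, a t * (f (g t) ω - 1)|}
      ≤ P.real ({ω | ε ≤ ∑ t ∈ s, a t * (f (g t) ω - 1)} ∪
          {ω | ε ≤ (-fun ω => ∑ t ∈ s, a t * (f (g t) ω - 1)) ω}) := by
        refine measureReal_mono fun ω hω => ?_
        simp only [Set.mem_union, Set.mem_ofPred_eq] at hω ⊢
        exact le_abs.mp hω
    _ ≤ _ := measureReal_union_le _ _
    _ ≤ _ := by linarith

/-- The sum of products of pairs, over disjoint pairs, of an independent family. -/
lemma hasSubgaussianMGF_sum_mul (hf : iIndepFun f P) (hm : ∀ i, Measurable (f i))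
    (hC : 0 ≤ C) (hb : ∀ i, ∀ᵐ ω ∂P, f i ω ∈ Set.Icc 0 C) (h1 : ∀ i, ∫ ω, f i ω ∂P = 1)
    {g₁ g₂ : τ → ι} (s : Finset τ) (hg₁ : Set.InjOn g₁ s) (hg₂ : Set.InjOn g₂ s)
    (hg : ∀ z ∈ s, ∀ z' ∈ s, g₁ z ≠ g₂ z') :
    HasSubgaussianMGF (fun ω => ∑ z ∈ s, (f (g₁ z) ω * f (g₂ z) ω - 1))
      (s.card * (‖C ^ 2 - 0‖₊ / 2) ^ 2) P := by
  classical
  induction s using Finset.induction_on with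
  | empty => simp
  | insert z s hz ih =>
    have hzs : ∀ y ∈ s, y ≠ z := fun y hy h => hz (h ▸ hy)
    have hsub := ih (hg₁.mono (by simp)) (hg₂.mono (by simp)) fun y hy y' hy' =>
      hg y (by simp [hy]) y' (by simp [hy'])
    have hmean : ∫ ω, f (g₁ z) ω * f (g₂ z) ω ∂P = 1 := by
      have := (hf.indepFun (hg z (by simp) z (by simp))).integral_mul_eq_mul_integral
        (hm _).aestronglyMeasurable (hm _).aestronglyMeasurable
      simpa [h1] using this
    have hone : HasSubgaussianMGF (fun ω => f (g₁ z) ω * f (g₂ z) ω - 1)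
        ((‖C ^ 2 - 0‖₊ / 2) ^ 2) P := by
      rw [← hmean]
      refine hasSubgaussianMGF_of_mem_Icc ((hm _).mul (hm _)).aemeasurable ?_
      filter_upwards [hb (g₁ z), hb (g₂ z)] with ω h h'
      refine ⟨mul_nonneg h.1 h'.1, ?_⟩
      rw [sq]
      exact mul_le_mul h.2 h'.2 h'.1 hC
    -- The new product depends only on indices in `S`, the earlier sum only on indices in `T`;
    -- disjointness makes them independent.
    let S : Finset ι := {g₁ z, g₂ z}
    let T : Finset ι := s.image g₁ ∪ s.image g₂
    have hdisj : Disjoint S T := by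
      rw [Finset.disjoint_left]
      intro i hi hi'
      simp only [S, T, Finset.mem_insert, Finset.mem_singleton, Finset.mem_union,
        Finset.mem_image] at hi hi'
      rcases hi with rfl | rfl <;> rcases hi' with ⟨y, hy, h⟩ | ⟨y, hy, h⟩
      · exact hzs y hy (hg₁ (by simp [hy]) (by simp) h)
      · exact hg z (by simp) y (by simp [hy]) h.symm
      · exact hg y (by simp [hy]) z (by simp) h
      · exact hzs y hy (hg₂ (by simp [hy]) (by simp) h)
    have hindep := hf.indepFun_finset S T hdisj hm
    have hindep' : IndepFun (fun ω => f (g₁ z) ω * f (g₂ z) ω - 1)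
        (fun ω => ∑ y ∈ s, (f (g₁ y) ω * f (g₂ y) ω - 1)) P := by
      have hcomp := hindep.comp
        (φ := fun u : S → ℝ => u ⟨g₁ z, by simp [S]⟩ * u ⟨g₂ z, by simp [S]⟩ - 1)
        (ψ := fun u : T → ℝ => ∑ y : s,
          (u ⟨g₁ y, by simp only [T, Finset.mem_union, Finset.mem_image]; exact .inl ⟨y, y.2, rfl⟩⟩ *
            u ⟨g₂ y, by simp only [T, Finset.mem_union, Finset.mem_image]; exact .inr ⟨y, y.2, rfl⟩⟩
            - 1)) (by fun_prop) (by fun_prop)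
      convert! hcomp using 1
      funext ω
      exact (Finset.sum_coe_sort s fun y => f (g₁ y) ω * f (g₂ y) ω - 1).symm
    have := hone.add_of_indepFun hsub hindep'
    simp only [Finset.sum_insert hz, Finset.card_insert_of_notMem hz]
    convert this using 1
    push_cast
    ring

theorem measureReal_sum_mul_le_le (hf : iIndepFun f P) (hm : ∀ i, Measurable (f i))
    (hC : 0 < C) (hb : ∀ i, ∀ᵐ ω ∂P, f i ω ∈ Set.Icc 0 C) (h1 : ∀ i, ∫ ω, f i ω ∂P = 1)
    {g₁ g₂ : τ → ι} (s : Finset τ) (hg₁ : Set.InjOn g₁ s) (hg₂ : Set.InjOn g₂ s)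
    (hg : ∀ z ∈ s, ∀ z' ∈ s, g₁ z ≠ g₂ z') :
    P.real {ω | ∑ z ∈ s, f (g₁ z) ω * f (g₂ z) ω ≤ (s.card : ℝ) / 2} ≤
      Real.exp (-s.card / (2 * C ^ 4)) := by
  have h := (hasSubgaussianMGF_sum_mul hf hm hC.le hb h1 s hg₁ hg₂ hg).neg.measure_ge_le
    (ε := (s.card : ℝ) / 2) (by positivity)
  have hset : {ω | ∑ z ∈ s, f (g₁ z) ω * f (g₂ z) ω ≤ (s.card : ℝ) / 2} =
      {ω | (s.card : ℝ) / 2 ≤ (-fun ω => ∑ z ∈ s, (f (g₁ z) ω * f (g₂ z) ω - 1)) ω} := by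
    ext ω
    simp only [Set.mem_ofPred_eq, Pi.neg_apply, Finset.sum_sub_distrib, Finset.sum_const,
      nsmul_eq_mul, mul_one]
    constructor <;> intro h <;> linarith
  rw [hset]
  refine h.trans (Real.exp_le_exp.mpr (le_of_eq ?_))
  rcases s.card.eq_zero_or_pos with h0 | h0
  · simp [h0]
  · push_cast
    rw [sub_zero, Real.norm_eq_abs, abs_of_nonneg (by positivity)]
    have : (0 : ℝ) < s.card := by exact_mod_cast h0
    field_simp

end Concentration

/-! ### Drift coefficients: summability, oddness and truncation. -/

section Geometry

variable {d : ℕ}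

@[simp] lemma toEuclidean_apply (z : Lattice d) (i : Fin d) : toEuclidean z i = z i := rfl

@[simp] lemma toEuclidean_zero : toEuclidean (0 : Lattice d) = 0 := by
  ext i
  simp

lemma toEuclidean_neg (z : Lattice d) : toEuclidean (-z) = -toEuclidean z := by
  ext i
  simp

lemma toEuclidean_injective : Function.Injective (toEuclidean (d := d)) := fun x y h => by
  funext i
  have := congrArg (fun v : EuclideanSpace ℝ (Fin d) => v i) h
  simpa using this

lemma abs_apply_le_norm (z : Lattice d) (i : Fin d) : |(z i : ℝ)| ≤ ‖toEuclidean z‖ := by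
  simpa using PiLp.norm_apply_le (toEuclidean z) i

lemma norm_toEuclidean_le {z : Lattice d} {R : ℝ} (hR : 0 ≤ R) (h : ∀ i, |(z i : ℝ)| ≤ R) :
    ‖toEuclidean z‖ ≤ d * R := by
  rw [EuclideanSpace.norm_eq]
  refine Real.sqrt_le_iff.mpr ⟨by positivity, ?_⟩
  calc ∑ i, ‖toEuclidean z i‖ ^ 2 ≤ ∑ _i : Fin d, R ^ 2 := by
        refine Finset.sum_le_sum fun i _ => ?_
        have := h i
        simp only [toEuclidean_apply, Real.norm_eq_abs]
        gcongr
    _ = d * R ^ 2 := by simp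
    _ ≤ (d : ℝ) ^ 2 * R ^ 2 := by
        gcongr
        exact_mod_cast Nat.le_self_pow two_ne_zero d
    _ = _ := by ring

/-- The decay `|z|^{-(d+α-1)}` of the drift coefficients. -/
noncomputable def decay (α : ℝ) (z : Lattice d) : ℝ := ‖toEuclidean z‖ ^ (1 - ((d : ℝ) + α))

lemma decay_nonneg (α : ℝ) (z : Lattice d) : 0 ≤ decay α z := by
  unfold decay
  positivity

lemma toEuclidean_mem_span {b : Module.Basis (Fin d) ℝ (EuclideanSpace ℝ (Fin d))}
    (hb : ∀ i, b i = EuclideanSpace.single i 1) (z : Lattice d) :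
    toEuclidean z ∈ Submodule.span ℤ (Set.range b) := by
  have : toEuclidean z = ∑ i, z i • b i := by
    ext j
    simp [hb, Finset.sum_apply, Pi.single_apply]
  rw [this]
  exact Submodule.sum_mem _ fun i _ =>
    Submodule.smul_mem _ _ (Submodule.subset_span (Set.mem_range_self i))

lemma finrank_span_basis (b : Module.Basis (Fin d) ℝ (EuclideanSpace ℝ (Fin d))) :
    Module.finrank ℤ (Submodule.span ℤ (Set.range b)) = d := by
  have := Module.finrank_eq_card_basis (b.restrictScalars ℤ)
  rwa [Fintype.card_fin] at this

lemma summable_norm_rpow_span (b : Module.Basis (Fin d) ℝ (EuclideanSpace ℝ (Fin d))) {r : ℝ}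
    (hr : r < -d) : Summable fun v : Submodule.span ℤ (Set.range b) => ‖v‖ ^ r :=
  ZLattice.summable_norm_rpow (Submodule.span ℤ (Set.range b)) r (by rwa [finrank_span_basis])

/-- The decay exponent `d + α - 1` exceeds the rank `d` of the lattice exactly because `α > 1`. -/
lemma summable_decay {α : ℝ} (hα : 1 < α) : Summable (decay α : Lattice d → ℝ) := by
  obtain ⟨b, hb⟩ : ∃ b : Module.Basis (Fin d) ℝ (EuclideanSpace ℝ (Fin d)),
      ∀ i, b i = EuclideanSpace.single i 1 :=
    ⟨(EuclideanSpace.basisFun (Fin d) ℝ).toBasis, fun i => by simp⟩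
  have hr : 1 - ((d : ℝ) + α) < -d := by linarith
  have hs := summable_norm_rpow_span b hr
  let j : Lattice d → Submodule.span ℤ (Set.range b) := fun z => ⟨_, toEuclidean_mem_span hb z⟩
  have hinj : Function.Injective j :=
    fun x y h => toEuclidean_injective (congrArg Subtype.val h)
  refine (hs.comp_injective hinj).congr fun z => ?_
  rw [Function.comp_apply, decay, Submodule.coe_norm]

/-- The coordinate `i` of the drift coefficient `z / |z|^{d+α}`. -/
noncomputable def driftCoeff (α : ℝ) (i : Fin d) (z : Lattice d) : ℝ :=
  z i / ‖toEuclidean z‖ ^ ((d : ℝ) + α)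

lemma driftCoeff_neg (α : ℝ) (i : Fin d) (z : Lattice d) :
    driftCoeff α i (-z) = -driftCoeff α i z := by
  simp [driftCoeff, toEuclidean_neg, neg_div]

lemma norm_div_rpow_eq_decay {α : ℝ} (hα : 1 < α) (z : Lattice d) :
    ‖toEuclidean z‖ / ‖toEuclidean z‖ ^ ((d : ℝ) + α) = decay α z := by
  have hd : (0 : ℝ) ≤ d := by positivity
  rcases (norm_nonneg (toEuclidean z)).eq_or_lt with h | h
  -- At `z = 0` both sides vanish, since a nonzero real power of zero is zero by convention.
  · rw [decay, ← h, zero_div, Real.zero_rpow (by linarith)]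
  · rw [decay, Real.rpow_sub h, Real.rpow_one]

lemma abs_driftCoeff_le {α : ℝ} (hα : 1 < α) (i : Fin d) (z : Lattice d) :
    |driftCoeff α i z| ≤ decay α z := by
  rw [← norm_div_rpow_eq_decay hα, driftCoeff, abs_div,
    abs_of_nonneg (by positivity : 0 ≤ ‖toEuclidean z‖ ^ ((d : ℝ) + α))]
  gcongr
  exact abs_apply_le_norm z i

lemma summable_driftCoeff {α : ℝ} (hα : 1 < α) (i : Fin d) :
    Summable (driftCoeff α i) :=
  Summable.of_norm_bounded (summable_decay hα) fun z => abs_driftCoeff_le hα i z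

/-- The coefficient is odd under reflection. This is what allows `w` to be replaced by `w - 1` in
the drift. -/
lemma tsum_driftCoeff (α : ℝ) (i : Fin d) : ∑' z, driftCoeff α i z = 0 := by
  have h : ∑' z, driftCoeff α i z = ∑' z, driftCoeff α i (-z) :=
    ((Equiv.neg (Lattice d)).tsum_eq (driftCoeff α i)).symm
  simp only [driftCoeff_neg, tsum_neg] at h
  linarith

/-- The `ℓ²` norm is at most the `ℓ¹` norm; the resulting variance bound does not depend on the
truncation `F`. -/
lemma sum_sq_driftCoeff_le {α : ℝ} (hα : 1 < α) (i : Fin d) (F : Finset (Lattice d)) :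
    ∑ z ∈ F, driftCoeff α i z ^ 2 ≤ (∑' z : Lattice d, decay α z) ^ 2 := by
  calc ∑ z ∈ F, driftCoeff α i z ^ 2 ≤ ∑ z ∈ F, decay α z ^ 2 := by
        refine Finset.sum_le_sum fun z _ => ?_
        rw [← sq_abs]
        have := abs_driftCoeff_le hα i z
        gcongr
    _ ≤ (∑ z ∈ F, decay α z) ^ 2 := by
        rw [sq (∑ z ∈ F, decay α z), Finset.sum_mul]
        refine Finset.sum_le_sum fun z hz => ?_
        rw [sq]
        exact mul_le_mul_of_nonneg_left
          (Finset.single_le_sum (fun y _ => decay_nonneg α y) hz) (decay_nonneg α z)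
    _ ≤ _ := by
        have h0 : 0 ≤ ∑ z ∈ F, decay α z := Finset.sum_nonneg fun z _ => decay_nonneg α z
        gcongr
        exact (summable_decay hα).sum_le_tsum _ fun z _ => decay_nonneg α z

/-- The conductances `w` take values in `[0, C]` off the diagonal. -/
def BoundedBy (w : Sym2 (Lattice d) → ℝ) (C : ℝ) : Prop :=
  ∀ x y, x ≠ y → w s(x, y) ∈ Set.Icc 0 C

lemma abs_driftCoeff_mul_le {α C : ℝ} (hα : 1 < α) {u : Lattice d → ℝ}
    (hu : ∀ z, z ≠ 0 → |u z| ≤ C) (i : Fin d) (z : Lattice d) :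
    |driftCoeff α i z * u z| ≤ C * decay α z := by
  rcases eq_or_ne z 0 with rfl | hz
  · have : (1 : ℝ) - (d + α) ≠ 0 := by
      have hd : (0 : ℝ) ≤ d := by positivity
      linarith
    simp [driftCoeff, decay, Real.zero_rpow this]
  · rw [abs_mul, mul_comm]
    have := abs_driftCoeff_le hα i z
    exact mul_le_mul (hu z hz) this (abs_nonneg _) ((abs_nonneg _).trans (hu z hz))

lemma drift_apply {α C : ℝ} (hα : 1 < α) {w : Sym2 (Lattice d) → ℝ} (hw : BoundedBy w C)
    (x : Lattice d) (i : Fin d) :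
    drift α w x i = ∑' z, driftCoeff α i z * w s(x, x + z) := by
  have hbound : ∀ z, z ≠ 0 → |w s(x, x + z)| ≤ C := fun z hz => by
    have := hw x (x + z) (by simpa using hz)
    rw [abs_of_nonneg this.1]
    exact this.2
  have hs : Summable fun z : Lattice d =>
      (w s(x, x + z) / ‖toEuclidean z‖ ^ ((d : ℝ) + α)) • toEuclidean z := by
    refine Summable.of_norm_bounded ((summable_decay hα).mul_left C) fun z => ?_
    rcases eq_or_ne z 0 with rfl | hz
    · have : (1 : ℝ) - (d + α) ≠ 0 := by
        have hd : (0 : ℝ) ≤ d := by positivity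
        linarith
      simp [decay, Real.zero_rpow this]
    · rw [norm_smul, norm_div, Real.norm_eq_abs, Real.norm_eq_abs,
        abs_of_nonneg (by positivity : 0 ≤ ‖toEuclidean z‖ ^ ((d : ℝ) + α)),
        ← norm_div_rpow_eq_decay hα, div_mul_eq_mul_div, mul_div_assoc]
      gcongr
      exact hbound z hz
  have := (EuclideanSpace.proj i : EuclideanSpace ℝ (Fin d) →L[ℝ] ℝ).map_tsum hs
  refine this.trans ?_
  refine tsum_congr fun z => ?_
  change w s(x, x + z) / ‖toEuclidean z‖ ^ ((d : ℝ) + α) * (z i : ℝ) = _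
  rw [driftCoeff]
  ring

lemma abs_drift_apply_le {α C : ℝ} (hα : 1 < α) {w : Sym2 (Lattice d) → ℝ} (hw : BoundedBy w C)
    (x : Lattice d) (i : Fin d) : |drift α w x i| ≤ C * ∑' z : Lattice d, decay α z := by
  rw [drift_apply hα hw, ← tsum_mul_left, ← Real.norm_eq_abs]
  refine tsum_of_norm_bounded ((summable_decay hα).mul_left C).hasSum fun z => ?_
  rw [Real.norm_eq_abs]
  refine abs_driftCoeff_mul_le hα (u := fun z => w s(x, x + z)) (fun z hz => ?_) i z
  have := hw x (x + z) (by simpa using hz)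
  rw [abs_of_nonneg this.1]
  exact this.2

/-- The drift is approximated, uniformly in `x`, by the finite centred sums. -/
lemma abs_drift_sub_sum_le {α C : ℝ} (hα : 1 < α) {w : Sym2 (Lattice d) → ℝ}
    (hw : BoundedBy w C) (F : Finset (Lattice d)) (x : Lattice d) (i : Fin d) :
    |drift α w x i - ∑ z ∈ F, driftCoeff α i z * (w s(x, x + z) - 1)| ≤
      (C + 1) * ∑' z : {z // z ∉ F}, decay α z.1 := by
  have hu : ∀ z, z ≠ 0 → |w s(x, x + z) - 1| ≤ C + 1 := fun z hz => by
    have := hw x (x + z) (by simpa using hz)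
    rw [abs_le]
    constructor <;> linarith [this.1, this.2]
  have hle := abs_driftCoeff_mul_le hα (u := fun z => w s(x, x + z) - 1) hu i
  have hs : Summable fun z => driftCoeff α i z * (w s(x, x + z) - 1) :=
    Summable.of_norm_bounded ((summable_decay hα).mul_left (C + 1)) hle
  have hcentre : drift α w x i = ∑' z, driftCoeff α i z * (w s(x, x + z) - 1) := by
    have h0 := summable_driftCoeff hα i
    have h : ∀ z, driftCoeff α i z * w s(x, x + z) =
        driftCoeff α i z * (w s(x, x + z) - 1) + driftCoeff α i z := fun z => by ring
    rw [drift_apply hα hw, tsum_congr h, hs.tsum_add h0, tsum_driftCoeff, add_zero]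
  rw [hcentre, ← hs.sum_add_tsum_subtype_compl F, add_sub_cancel_left, ← tsum_mul_left,
    ← Real.norm_eq_abs]
  exact tsum_of_norm_bounded
    (((summable_decay hα).mul_left (C + 1)).subtype {z | z ∉ F}).hasSum fun z => hle z.1

/-- Finite sets of displacements with arbitrarily small tails. -/
lemma exists_finset_tail_le (α : ℝ) {δ : ℝ} (hδ : 0 < δ) :
    ∃ F : Finset (Lattice d), ∑' z : {z // z ∉ F}, decay α z.1 ≤ δ := by
  have h := tendsto_tsum_compl_atTop_zero (decay α : Lattice d → ℝ)
  obtain ⟨F, hF⟩ := ((tendsto_order.mp h).2 δ hδ).exists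
  exact ⟨F, hF.le⟩

end Geometry

/-! ### Dyadic cells of the cube. -/

section Cells

variable {d : ℕ}

/-- The index of the dyadic cell of side `2^n` containing `x`, for the dyadic partitions of the
cube `(-2^m, 2^m]^d`; the cell of side `2^{m+1}` is the whole cube. -/
def cell (m n : ℕ) (x : Lattice d) : Lattice d := fun i => (x i - 1 + 2 ^ m) / 2 ^ n

/-- The dyadic cell of side `2^n` containing `x`. -/
noncomputable def block (m n : ℕ) (x : Lattice d) : Finset (Lattice d) :=
  (box d (2 ^ m)).filter fun y => cell m n y = cell m n x

lemma mem_box {R : ℤ} {x : Lattice d} : x ∈ box d R ↔ ∀ i, -R < x i ∧ x i ≤ R := by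
  simp [box]

lemma cell_succ (m n : ℕ) {x y : Lattice d} (h : cell m n x = cell m n y) :
    cell m (n + 1) x = cell m (n + 1) y := by
  funext i
  have hi := congrFun h i
  simp only [cell] at hi ⊢
  rw [pow_succ, ← Int.ediv_ediv_of_nonneg (by positivity),
    ← Int.ediv_ediv_of_nonneg (by positivity), hi]

lemma cell_top (m : ℕ) {x : Lattice d} (hx : x ∈ box d (2 ^ m)) : cell m (m + 1) x = 0 := by
  funext i
  have := mem_box.mp hx i
  simp only [cell, Pi.zero_apply]
  refine Int.ediv_eq_zero_of_lt (by linarith) ?_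
  rw [pow_succ]
  linarith

lemma abs_sub_lt_of_cell_eq {m n : ℕ} {x y : Lattice d} (h : cell m n x = cell m n y)
    (i : Fin d) : |x i - y i| < 2 ^ n := by
  have hi := congrFun h i
  simp only [cell] at hi
  have hpos : (0 : ℤ) < 2 ^ n := by positivity
  have h1 := Int.mul_ediv_add_emod (x i - 1 + 2 ^ m) (2 ^ n)
  have h2 := Int.mul_ediv_add_emod (y i - 1 + 2 ^ m) (2 ^ n)
  have h3 := Int.emod_nonneg (x i - 1 + 2 ^ m) hpos.ne'
  have h4 := Int.emod_nonneg (y i - 1 + 2 ^ m) hpos.ne'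
  have h5 := Int.emod_lt_of_pos (x i - 1 + 2 ^ m) hpos
  have h6 := Int.emod_lt_of_pos (y i - 1 + 2 ^ m) hpos
  rw [hi] at h1
  rw [abs_lt]
  constructor <;> linarith

lemma norm_sub_le_of_cell_eq {m n : ℕ} {x y : Lattice d} (h : cell m n x = cell m n y) :
    ‖toEuclidean (x - y)‖ ≤ d * 2 ^ n := by
  refine norm_toEuclidean_le (by positivity) fun i => ?_
  have := (abs_sub_lt_of_cell_eq h i).le
  simp only [Pi.sub_apply]
  exact_mod_cast this

/-- The shift by `2 ^ m - 1` carries the cube to `[0, 2^(m+1))^d`, whose side is a multiple of `2 ^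
n`; hence no cell is cut by the boundary. -/
lemma card_block {m n : ℕ} (hn : n ≤ m + 1) {x : Lattice d} (hx : x ∈ box d (2 ^ m)) :
    (block m n x).card = 2 ^ (n * d) := by
  have hpos : (0 : ℤ) < 2 ^ n := by positivity
  have heq : block m n x = Fintype.piFinset fun i : Fin d =>
      Finset.Ico (cell m n x i * 2 ^ n + 1 - 2 ^ m) (cell m n x i * 2 ^ n + 1 - 2 ^ m + 2 ^ n) := by
    ext y
    simp only [block, Finset.mem_filter, mem_box, Fintype.mem_piFinset, Finset.mem_Ico]
    have hkey : ∀ i, (y i - 1 + 2 ^ m) / 2 ^ n = cell m n x i ↔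
        cell m n x i * 2 ^ n + 1 - 2 ^ m ≤ y i ∧
          y i < cell m n x i * 2 ^ n + 1 - 2 ^ m + 2 ^ n := by
      intro i
      rw [Int.ediv_eq_iff_of_pos hpos]
      constructor <;> rintro ⟨h1, h2⟩ <;> constructor <;> linarith
    constructor
    · rintro ⟨-, h⟩ i
      exact (hkey i).mp (congrFun h i)
    · intro h
      refine ⟨fun i => ?_, funext fun i => (hkey i).mpr (h i)⟩
      have hxi := mem_box.mp hx i
      have hq0 : 0 ≤ cell m n x i := Int.ediv_nonneg (by linarith) hpos.le
      have hsplit : (2 : ℤ) ^ (m + 1 - n) * 2 ^ n = 2 * 2 ^ m := by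
        rw [← pow_add, Nat.sub_add_cancel hn, pow_succ, mul_comm]
      have hq1 : cell m n x i + 1 ≤ 2 ^ (m + 1 - n) := by
        refine Int.add_one_le_iff.mpr (Int.ediv_lt_of_lt_mul hpos ?_)
        rw [hsplit]
        linarith
      have h0 := mul_nonneg hq0 hpos.le
      have h1 := mul_le_mul_of_nonneg_right hq1 hpos.le
      rw [hsplit] at h1
      have := h i
      constructor <;> linarith
  rw [heq, Fintype.card_piFinset]
  simp only [Int.card_Ico, add_sub_cancel_left]
  have : ((2 : ℤ) ^ n).toNat = 2 ^ n := by
    rw [Int.toNat_pow_of_nonneg (by norm_num)]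
    rfl
  rw [this, Finset.prod_const, Finset.card_univ, Fintype.card_fin, ← pow_mul]

lemma card_box (m : ℕ) : (box d (2 ^ m)).card = 2 ^ ((m + 1) * d) := by
  have hx : (1 : Lattice d) ∈ box d (2 ^ m) := mem_box.mpr fun i => by
    have : (0 : ℤ) < 2 ^ m := by positivity
    simp only [Pi.one_apply]
    constructor <;> linarith
  rw [← card_block le_rfl hx, block, Finset.filter_true_of_mem fun y hy => by
    rw [cell_top m hy, cell_top m hx]]

lemma sum_subtype_block (m n : ℕ) (x : box d (2 ^ m)) (F : Lattice d → ℝ) :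
    ∑ y : box d (2 ^ m) with cell m n y.1 = cell m n x.1, F y = ∑ y ∈ block m n x, F y := by
  rw [Finset.sum_filter, block, Finset.sum_filter]
  exact Finset.sum_coe_sort (box d (2 ^ m))
    fun y => if cell m n y = cell m n x then F y else 0

lemma card_subtype_block {m n : ℕ} (hn : n ≤ m + 1) (x : box d (2 ^ m)) :
    (Finset.univ.filter fun y : box d (2 ^ m) => cell m n y.1 = cell m n x.1).card =
      2 ^ (n * d) := by
  have := sum_subtype_block m n x fun _ => 1
  simp only [Finset.sum_const, nsmul_eq_mul, mul_one] at this
  rw [← card_block hn x.2]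
  exact_mod_cast this

end Cells

/-! ### Probabilities of the good events, and Borel–Cantelli. -/

section GoodEvents

variable {d : ℕ}

/-- Every two distinct points of a cell of side `2^n` are joined by many two-step paths inside
the cell. -/
def PathBound (w : Sym2 (Lattice d) → ℝ) (m n : ℕ) : Prop :=
  ∀ x ∈ box d (2 ^ m), ∀ y ∈ box d (2 ^ m), x ≠ y → cell m n y = cell m n x →
    (2 : ℝ) ^ (n * d) / 4 ≤ ∑ z ∈ block m n x \ {x, y}, w s(x, z) * w s(y, z)

/-- The centred drift, with displacements in `F`, has sums at most `ε` over the cells of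
side `2^n`. -/
def DriftBound (α : ℝ) (w : Sym2 (Lattice d) → ℝ) (m n : ℕ) (F : Finset (Lattice d)) (ε : ℝ) :
    Prop :=
  ∀ x ∈ box d (2 ^ m), ∀ i : Fin d,
    |∑ u ∈ block m n x, ∑ z ∈ F, driftCoeff α i z * (w s(u, u + z) - 1)| ≤ ε

/-- The edge between two distinct points; an arbitrary edge if the points coincide. -/
noncomputable def edge [Nonempty (Edge d)] (x y : Lattice d) : Edge d :=
  if h : x ≠ y then ⟨s(x, y), by simpa using h⟩ else Classical.arbitrary _

lemma edge_coe [Nonempty (Edge d)] {x y : Lattice d} (h : x ≠ y) :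
    (edge x y : Sym2 (Lattice d)) = s(x, y) := by
  simp [edge, h]

variable {Ω : Type*} [MeasurableSpace Ω] {P : Measure Ω} [IsProbabilityMeasure P]
  {w : Sym2 (Lattice d) → Ω → ℝ} {C : ℝ}

/-- The edges from `x` and from `y` to the midpoints are pairwise distinct, so the products are
independent with mean one. Removing `x` and `y` leaves at least half of `Q`, which accounts for the
two factors `4`. -/
lemma measureReal_path_lt_le [Nonempty (Edge d)] (hw : IIDConductances P w) (hC : 0 < C)
    (hb : ∀ e : Edge d, ∀ᵐ ω ∂P, w e ω ∈ Set.Icc 0 C) {Q : Finset (Lattice d)} (hQ : 4 ≤ Q.card)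
    {x y : Lattice d} (hx : x ∈ Q) (hy : y ∈ Q) (hxy : x ≠ y) :
    P.real {ω | ∑ z ∈ Q \ {x, y}, w s(x, z) ω * w s(y, z) ω < (Q.card : ℝ) / 4} ≤
      Real.exp (-Q.card / (4 * C ^ 4)) := by
  have hne : ∀ z ∈ Q \ {x, y}, x ≠ z ∧ y ≠ z := by
    intro z hz
    simp only [Finset.mem_sdiff, Finset.mem_insert, Finset.mem_singleton, not_or] at hz
    exact ⟨Ne.symm hz.2.1, Ne.symm hz.2.2⟩
  have hinj : ∀ u : Lattice d, (∀ z ∈ Q \ {x, y}, u ≠ z) →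
      Set.InjOn (fun z => edge u z) (Q \ {x, y} : Finset (Lattice d)) := by
    intro u hu z hz z' hz' h
    have h' := congrArg Subtype.val h
    simp only [edge_coe (hu z hz), edge_coe (hu z' hz')] at h'
    exact Sym2.congr_right.mp h'
  have h := measureReal_sum_mul_le_le (P := P) (f := fun e : Edge d => w e) (C := C)
    (g₁ := fun z => edge x z) (g₂ := fun z => edge y z)
    hw.indep hw.measurable hC hb hw.mean_one (Q \ {x, y})
    (hinj x fun z hz => (hne z hz).1) (hinj y fun z hz => (hne z hz).2) (by
      intro z hz z' hz' h
      have h' := congrArg Subtype.val h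
      simp only [edge_coe (hne z hz).1, edge_coe (hne z' hz').2, Sym2.eq_iff] at h'
      rcases h' with ⟨h1, -⟩ | ⟨h1, -⟩
      · exact hxy h1
      · exact (hne z' hz').1 h1)
  have hcard : (Q \ {x, y}).card + 2 = Q.card := by
    rw [← Finset.card_pair hxy]
    exact Finset.card_sdiff_add_card_eq_card (by
      intro z hz
      rcases Finset.mem_insert.mp hz with rfl | hz
      · exact hx
      · exact Finset.mem_singleton.mp hz ▸ hy)
  have hcard' : ((Q \ {x, y}).card : ℝ) + 2 = Q.card := by exact_mod_cast hcard
  have hQ' : (4 : ℝ) ≤ Q.card := by exact_mod_cast hQ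
  refine (measureReal_mono ?_).trans (h.trans (Real.exp_le_exp.mpr ?_))
  · intro ω hω
    simp only [Set.mem_ofPred_eq] at hω ⊢
    have : ∑ z ∈ Q \ {x, y}, w (edge x z) ω * w (edge y z) ω =
        ∑ z ∈ Q \ {x, y}, w s(x, z) ω * w s(y, z) ω :=
      Finset.sum_congr rfl fun z hz => by rw [edge_coe (hne z hz).1, edge_coe (hne z hz).2]
    rw [this]
    linarith
  · rw [div_le_div_iff₀ (by positivity) (by positivity)]
    have : (0 : ℝ) < C ^ 4 := by positivity
    nlinarith

/-- An edge `{u, u + z}` has only one other description, by base point `u + z` and displacement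
`-z`. Excluding opposite displacements makes the edges distinct, so Hoeffding applies to the double
sum. -/
lemma measureReal_drift_ge_le [Nonempty (Edge d)] {α : ℝ} (hα : 1 < α)
    (hw : IIDConductances P w)
    (hb : ∀ e : Edge d, ∀ᵐ ω ∂P, w e ω ∈ Set.Icc 0 C) (Q : Finset (Lattice d))
    {F : Finset (Lattice d)} (hF : ∀ z ∈ F, -z ∉ F) (i : Fin d) {ε : ℝ} (hε : 0 ≤ ε) :
    P.real {ω | ε ≤ |∑ u ∈ Q, ∑ z ∈ F, driftCoeff α i z * (w s(u, u + z) ω - 1)|} ≤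
      2 * Real.exp (-ε ^ 2 / (Q.card * (∑' z : Lattice d, decay α z + 1) ^ 2 * C ^ 2)) := by
  -- Zero is its own negative, so it is excluded from `F`.
  have hF0 : ∀ z ∈ F, ∀ u : Lattice d, u ≠ u + z := by
    intro z hz u h
    have : z = 0 := by simpa using h
    subst this
    exact hF 0 hz (by simpa using hz)
  have hR : 0 ≤ ∑' z : Lattice d, decay α z := tsum_nonneg fun z => decay_nonneg α z
  have h := measureReal_abs_weighted_sum_ge_le (P := P) (f := fun e : Edge d => w e) (C := C)
    (s := Q ×ˢ F) (g := fun p => edge p.1 (p.1 + p.2)) hw.indep hw.measurable hb hw.mean_one (by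
      rintro ⟨u, z⟩ hp ⟨u', z'⟩ hp' h
      simp only [Finset.coe_product, Set.mem_prod, Finset.mem_coe] at hp hp'
      have h' := congrArg Subtype.val h
      simp only [edge_coe (hF0 z hp.2 u), edge_coe (hF0 z' hp'.2 u'), Sym2.eq_iff] at h'
      rcases h' with ⟨h1, h2⟩ | ⟨h1, h2⟩
      · subst h1
        simpa using h2
      · exfalso
        refine hF z hp.2 ?_
        have : -z = z' := by
          rw [h1, add_assoc, add_eq_left] at h2
          exact neg_eq_of_add_eq_zero_left h2
        exact this ▸ hp'.2)
    (fun p => driftCoeff α i p.2) (S := Q.card * (∑' z : Lattice d, decay α z + 1) ^ 2) (by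
      rw [Finset.sum_product]
      change ∑ _u ∈ Q, ∑ z ∈ F, driftCoeff α i z ^ 2 ≤ _
      rw [Finset.sum_const, nsmul_eq_mul]
      gcongr
      refine (sum_sq_driftCoeff_le hα i F).trans ?_
      gcongr
      linarith) hε
  refine (measureReal_mono fun ω hω => ?_).trans h
  simp only [Set.mem_ofPred_eq] at hω ⊢
  rw [Finset.sum_product]
  have : ∀ u ∈ Q, ∀ z ∈ F, driftCoeff α i z * (w s(u, u + z) ω - 1) =
      driftCoeff α i z * (w (edge u (u + z)) ω - 1) := fun u _ z hz => by
    rw [edge_coe (hF0 z hz u)]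
  rwa [Finset.sum_congr rfl fun u hu => Finset.sum_congr rfl (this u hu)] at hω

lemma measureReal_not_pathBound_le [Nonempty (Edge d)] (hw : IIDConductances P w) (hC : 0 < C)
    (hb : ∀ e : Edge d, ∀ᵐ ω ∂P, w e ω ∈ Set.Icc 0 C) {m n : ℕ} (hn : n ≤ m + 1)
    (hnd : 4 ≤ 2 ^ (n * d)) :
    P.real {ω | ¬ PathBound (fun e => w e ω) m n} ≤
      (2 : ℝ) ^ ((m + 1) * d) * (2 ^ ((m + 1) * d) *
        Real.exp (-(2 : ℝ) ^ (n * d) / (4 * C ^ 4))) := by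
  classical
  let B : Lattice d → Lattice d → Set Ω := fun x y =>
    if x ≠ y ∧ cell m n y = cell m n x then
      {ω | ∑ z ∈ block m n x \ {x, y}, w s(x, z) ω * w s(y, z) ω < ((block m n x).card : ℝ) / 4}
    else ∅
  have hB : ∀ x ∈ box d (2 ^ m), ∀ y ∈ box d (2 ^ m),
      P.real (B x y) ≤ Real.exp (-(2 : ℝ) ^ (n * d) / (4 * C ^ 4)) := by
    intro x hx y hy
    by_cases h : x ≠ y ∧ cell m n y = cell m n x
    · have hcard := card_block hn hx
      have := measureReal_path_lt_le hw hC hb (Q := block m n x) (by rw [hcard]; exact hnd)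
        (x := x) (y := y) (by simp [block, hx]) (by simp [block, hy, h.2]) h.1
      simp only [B, if_pos h]
      refine this.trans (le_of_eq ?_)
      rw [hcard]
      push_cast
      rfl
    · simp only [B, if_neg h, measureReal_empty]
      positivity
  calc P.real {ω | ¬ PathBound (fun e => w e ω) m n}
      ≤ P.real (⋃ x ∈ box d (2 ^ m), ⋃ y ∈ box d (2 ^ m), B x y) := by
        refine measureReal_mono (fun ω hω => ?_) (measure_ne_top _ _)
        simp only [Set.mem_ofPred_eq, PathBound, not_forall, not_le] at hω
        obtain ⟨x, hx, y, hy, hxy, hc, h⟩ := hω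
        simp only [Set.mem_iUnion]
        refine ⟨x, hx, y, hy, ?_⟩
        simp only [B, if_pos (And.intro hxy hc), Set.mem_ofPred_eq, card_block hn hx]
        push_cast
        exact h
    _ ≤ ∑ x ∈ box d (2 ^ m), P.real (⋃ y ∈ box d (2 ^ m), B x y) :=
        measureReal_biUnion_finset_le _ _
    _ ≤ ∑ x ∈ box d (2 ^ m), ∑ y ∈ box d (2 ^ m), P.real (B x y) :=
        Finset.sum_le_sum fun x _ => measureReal_biUnion_finset_le _ _
    _ ≤ ∑ x ∈ box d (2 ^ m), ∑ y ∈ box d (2 ^ m),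
          Real.exp (-(2 : ℝ) ^ (n * d) / (4 * C ^ 4)) :=
        Finset.sum_le_sum fun x hx => Finset.sum_le_sum fun y hy => hB x hx y hy
    _ = _ := by
        simp only [Finset.sum_const, nsmul_eq_mul, card_box]
        push_cast
        ring

lemma measureReal_not_driftBound_le [Nonempty (Edge d)] {α : ℝ} (hα : 1 < α)
    (hw : IIDConductances P w)
    (hb : ∀ e : Edge d, ∀ᵐ ω ∂P, w e ω ∈ Set.Icc 0 C) {m n : ℕ} (hn : n ≤ m + 1)
    {F : Finset (Lattice d)} (hF : ∀ z ∈ F, -z ∉ F) {ε : ℝ} (hε : 0 ≤ ε) :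
    P.real {ω | ¬ DriftBound α (fun e => w e ω) m n F ε} ≤
      (2 : ℝ) ^ ((m + 1) * d) * (d * (2 * Real.exp (-ε ^ 2 /
        ((2 : ℝ) ^ (n * d) * (∑' z : Lattice d, decay α z + 1) ^ 2 * C ^ 2)))) := by
  let B : Lattice d → Fin d → Set Ω := fun x i =>
    {ω | ε ≤ |∑ u ∈ block m n x, ∑ z ∈ F, driftCoeff α i z * (w s(u, u + z) ω - 1)|}
  calc P.real {ω | ¬ DriftBound α (fun e => w e ω) m n F ε}
      ≤ P.real (⋃ x ∈ box d (2 ^ m), ⋃ i ∈ (Finset.univ : Finset (Fin d)), B x i) := by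
        refine measureReal_mono (fun ω hω => ?_) (measure_ne_top _ _)
        simp only [Set.mem_ofPred_eq, DriftBound, not_forall, not_le] at hω
        obtain ⟨x, hx, i, h⟩ := hω
        simp only [Set.mem_iUnion]
        exact ⟨x, hx, i, Finset.mem_univ i, h.le⟩
    _ ≤ ∑ x ∈ box d (2 ^ m), P.real (⋃ i ∈ (Finset.univ : Finset (Fin d)), B x i) :=
        measureReal_biUnion_finset_le _ _
    _ ≤ ∑ x ∈ box d (2 ^ m), ∑ i : Fin d, P.real (B x i) :=
        Finset.sum_le_sum fun x _ => measureReal_biUnion_finset_le _ _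
    _ ≤ ∑ x ∈ box d (2 ^ m), ∑ i : Fin d, 2 * Real.exp (-ε ^ 2 /
        ((2 : ℝ) ^ (n * d) * (∑' z : Lattice d, decay α z + 1) ^ 2 * C ^ 2)) := by
        refine Finset.sum_le_sum fun x hx => Finset.sum_le_sum fun i _ => ?_
        have := measureReal_drift_ge_le hα hw hb (block m n x) hF i hε
        rw [card_block hn hx] at this
        push_cast at this
        exact this
    _ = _ := by
        simp only [Finset.sum_const, nsmul_eq_mul, card_box, Finset.card_univ, Fintype.card_fin]
        push_cast
        ring

/-- Borel–Cantelli with a measurable random index. -/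
theorem exists_measurable_index {B : ℕ → Set Ω} (hB : Summable fun m => P.real (B m)) (m₀ : ℕ) :
    ∃ m₁ : Ω → ℕ, Measurable m₁ ∧ (∀ ω, m₀ ≤ m₁ ω) ∧
      ∀ᵐ ω ∂P, ∀ m, m₁ ω < m → ω ∉ B m := by
  classical
  -- Measurable hulls have the same measure, so the events need not be measurable.
  let T : ℕ → Set Ω := fun m => toMeasurable P (B m)
  have hT : ∀ m, MeasurableSet (T m) := fun m => measurableSet_toMeasurable P (B m)
  have hfin : ∑' m, P (T m) ≠ ⊤ := by
    have : ∀ m, P (T m) = ENNReal.ofReal (P.real (B m)) := fun m => by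
      rw [measure_toMeasurable, ofReal_measureReal]
    simp only [this]
    exact hB.tsum_ofReal_ne_top
  have hae := ae_eventually_notMem hfin
  let s : ℕ → Set Ω := fun N => {ω | ∀ m, N < m → ω ∉ T m}
  have hs : ∀ N, MeasurableSet (s N) := by
    intro N
    have : s N = ⋂ m, ⋂ _ : N < m, (T m)ᶜ := by
      ext ω
      simp [s]
    rw [this]
    exact MeasurableSet.iInter fun m => MeasurableSet.iInter fun _ => (hT m).compl
  -- The second alternative makes the search succeed, with value zero, on the null set where no
  -- index works.
  let p : Ω → ℕ → Prop := fun ω N => ω ∈ s N ∨ ω ∈ (⋃ N, s N)ᶜ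
  have hp : ∀ ω, ∃ N, p ω N := by
    intro ω
    by_cases h : ω ∈ ⋃ N, s N
    · obtain ⟨N, hN⟩ := Set.mem_iUnion.mp h
      exact ⟨N, .inl hN⟩
    · exact ⟨0, .inr h⟩
  have hmeas : Measurable fun ω => Nat.find (hp ω) := by
    refine measurable_find hp fun N => ?_
    exact (hs N).union (MeasurableSet.iUnion hs).compl
  refine ⟨fun ω => max m₀ (Nat.find (hp ω)), measurable_const.max hmeas,
    fun ω => le_max_left _ _, ?_⟩
  filter_upwards [hae] with ω hω m hm hmem
  obtain ⟨N, hN⟩ := Filter.eventually_atTop.mp hω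
  have hmemU : ω ∈ ⋃ N, s N := Set.mem_iUnion.mpr ⟨N, fun m hm => hN m hm.le⟩
  have hfind : ω ∈ s (Nat.find (hp ω)) := (Nat.find_spec (hp ω)).resolve_right fun h => h hmemU
  exact hfind m ((le_max_right _ _).trans_lt hm) (subset_toMeasurable P (B m) hmem)

end GoodEvents

/-! ### Energy bound for a fixed good environment. -/

section Deterministic

variable {d : ℕ} {α C : ℝ} {w : Sym2 (Lattice d) → ℝ}

lemma kernel_symm (α : ℝ) (w : Sym2 (Lattice d) → ℝ) (x y : Lattice d) :
    kernel α w x y = kernel α w y x := by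
  rw [kernel, kernel, Sym2.eq_swap, ← neg_sub y x, toEuclidean_neg, norm_neg]

lemma kernel_self (hα : 0 < α) (w : Sym2 (Lattice d) → ℝ) (x : Lattice d) :
    kernel α w x x = 0 := by
  have : (d : ℝ) + α ≠ 0 := by positivity
  simp [kernel, Real.zero_rpow this]

lemma kernel_nonneg (hα : 0 < α) (hw : BoundedBy w C) (x y : Lattice d) :
    0 ≤ kernel α w x y := by
  rcases eq_or_ne x y with rfl | h
  · rw [kernel_self hα]
  · exact div_nonneg (hw x y h).1 (by positivity)

/-- Separates the cell volume `2 ^ (n * d)`, which averaging over the cell cancels, from the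
Poincaré growth `(2 ^ α) ^ n`. -/
lemma mul_two_pow_rpow (α : ℝ) (n : ℕ) :
    ((d : ℝ) * 2 ^ n) ^ ((d : ℝ) + α) =
      2 ^ (n * d) * ((d : ℝ) ^ ((d : ℝ) + α) * ((2 : ℝ) ^ α) ^ n) := by
  rw [Real.mul_rpow (by positivity) (by positivity),
    Real.rpow_add (by positivity : (0 : ℝ) < 2 ^ n), Real.rpow_natCast, ← pow_mul,
    Real.rpow_pow_comm (by norm_num)]
  ring

/-- The Poincaré inequality on the cells of side `2^n`. -/
lemma sum_cell_sq_sub_le (hα : 0 < α) (hC : 0 < C) (hw : BoundedBy w C) {m n : ℕ}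
    (hn : n ≤ m + 1) (hpath : PathBound w m n) (f : box d (2 ^ m) → ℝ) :
    ∑ x : box d (2 ^ m), ∑ y : box d (2 ^ m) with cell m n y.1 = cell m n x.1, (f x - f y) ^ 2 ≤
      ((2 ^ (n * d) : ℕ) : ℝ) * (32 * C * (d : ℝ) ^ ((d : ℝ) + α) * ((2 : ℝ) ^ α) ^ n *
        dirichlet (fun x y : box d (2 ^ m) => kernel α w x y) f) := by
  classical
  -- The diagonal values of `w` are unconstrained and are set to zero.
  let W : Lattice d → Lattice d → ℝ := fun x y => if x = y then 0 else w s(x, y)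
  have hW0 : ∀ x y, 0 ≤ W x y := fun x y => by
    by_cases h : x = y
    · simp [W, h]
    · simpa [W, h] using (hw x y h).1
  have hWC : ∀ x y, W x y ≤ C := fun x y => by
    by_cases h : x = y
    · simpa [W, h] using hC.le
    · simpa [W, h] using (hw x y h).2
  have hρ : 0 ≤ ((d : ℝ) * 2 ^ n) ^ ((d : ℝ) + α) := by positivity
  have hWk : ∀ x y, cell m n y = cell m n x →
      W x y ≤ ((d : ℝ) * 2 ^ n) ^ ((d : ℝ) + α) * kernel α w x y := by
    intro x y hc
    by_cases h : x = y
    · simpa [W, h] using mul_nonneg hρ (kernel_nonneg hα hw y y)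
    · simp only [W, if_neg h, kernel]
      have hpos : 0 < ‖toEuclidean (x - y)‖ := by
        rw [norm_pos_iff]
        intro h0
        refine h (sub_eq_zero.mp (toEuclidean_injective (h0.trans toEuclidean_zero.symm)))
      rw [mul_div_assoc', le_div_iff₀ (by positivity), mul_comm]
      have h0 := (hw x y h).1
      gcongr
      exact norm_sub_le_of_cell_eq hc.symm
  have hpath' : ∀ x y : box d (2 ^ m), x ≠ y → cell m n y.1 = cell m n x.1 →
      ((2 ^ (n * d) : ℕ) : ℝ) / 4 ≤
        ∑ z : box d (2 ^ m) with cell m n z.1 = cell m n x.1, W x z * W y z := by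
    intro x y hxy hc
    rw [sum_subtype_block m n x fun z => W x z * W y z]
    push_cast
    refine (hpath x x.2 y y.2 (fun h => hxy (Subtype.ext h)) hc).trans ?_
    refine le_trans (le_of_eq ?_) (Finset.sum_le_sum_of_subset_of_nonneg
      (Finset.sdiff_subset (s := block m n x.1) (t := {x.1, y.1}))
      fun z _ _ => mul_nonneg (hW0 x z) (hW0 y z))
    refine Finset.sum_congr rfl fun z hz => ?_
    simp only [Finset.mem_sdiff, Finset.mem_insert, Finset.mem_singleton, not_or] at hz
    simp [W, Ne.symm hz.2.1, Ne.symm hz.2.2]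
  have h := sum_block_sq_sub_le (fun x : box d (2 ^ m) => cell m n x.1)
    (fun x => card_subtype_block hn x) (W := fun x y => W x y)
    (k := fun x y => kernel α w x y) hρ (fun x y => hW0 x y) (fun x y => hWC x y)
    (fun x y => kernel_nonneg hα hw x y) (fun x y hc => hWk x y hc) hpath' f
  refine h.trans (le_of_eq ?_)
  rw [mul_two_pow_rpow]
  push_cast
  ring

lemma localGenerator_apply (α : ℝ) (w : Sym2 (Lattice d) → ℝ) {U : Finset (Lattice d)}
    (φ : U → EuclideanSpace ℝ (Fin d)) (x : U) (i : Fin d) :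
    localGenerator α w U φ x i = ∑ y : U, kernel α w x y * (φ y i - φ x i) := by
  rw [← Finset.sum_erase (a := x) Finset.univ (by simp)]
  simp [localGenerator, WithLp.ofLp_sum, Finset.sum_apply]

lemma localEnergy_eq (α : ℝ) (w : Sym2 (Lattice d) → ℝ) {U : Finset (Lattice d)}
    (φ : U → EuclideanSpace ℝ (Fin d)) :
    localEnergy α w U φ =
      ∑ i, dirichlet (fun x y : U => kernel α w x y) fun x => φ x i := by
  simp only [localEnergy, dirichlet]
  rw [← Finset.mul_sum]
  congr 1
  refine Finset.sum_congr rfl fun i _ => Finset.sum_congr rfl fun x _ => ?_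
  exact Finset.sum_erase _ (by simp)

lemma mean_apply (U : Finset (Lattice d)) (f : Lattice d → EuclideanSpace ℝ (Fin d))
    (i : Fin d) : mean U f i = (U.card : ℝ)⁻¹ * ∑ x ∈ U, f x i := by
  simp [mean, WithLp.ofLp_sum, Finset.sum_apply]

/-- The local Poisson equation, coordinate by coordinate. -/
lemma isLocalCorrector_iff {U : Finset (Lattice d)} (φ : U → EuclideanSpace ℝ (Fin d)) :
    IsLocalCorrector α w U φ ↔ ∀ i, (∀ x : U, ∑ y : U, kernel α w x y * (φ y i - φ x i) =
      -drift α w x i + mean U (drift α w) i) ∧ ∑ x : U, φ x i = 0 := by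
  have hsum : ∀ i, (∑ x : U, φ x) i = ∑ x : U, φ x i := fun i => by
    simp [WithLp.ofLp_sum, Finset.sum_apply]
  constructor
  · rintro ⟨h1, h2⟩ i
    refine ⟨fun x => ?_, ?_⟩
    · rw [← localGenerator_apply, h1 x]
      simp
    · rw [← hsum, h2]
      simp
  · intro h
    refine ⟨fun x => ?_, ?_⟩
    · ext i
      rw [localGenerator_apply, (h i).1 x]
      simp
    · ext i
      rw [hsum, (h i).2]
      simp

/-- The compatibility condition for the Poisson equation. -/
lemma sum_neg_drift_add_mean {U : Finset (Lattice d)} (hU : U.Nonempty) (i : Fin d) :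
    ∑ x : U, (-drift α w x i + mean U (drift α w) i) = 0 := by
  have hcard : (U.card : ℝ) ≠ 0 := by exact_mod_cast hU.card_pos.ne'
  rw [Finset.sum_add_distrib, Finset.sum_neg_distrib, mean_apply,
    Finset.sum_coe_sort U fun x => drift α w x i]
  simp [hcard]

/-- The geometric sum over scales in the multiscale bound. -/
lemma sum_scale_le {b B : ℝ} (hb : 0 < b) (hbB : b < B) {t : ℝ} {n₀ M : ℕ}
    (ht : t ≤ B ^ n₀) :
    ∑ n ∈ Finset.Ico n₀ M, √t / √(B ^ n) * √(b ^ (n + 1)) ≤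
      √b / (1 - √(b / B)) * √(b ^ n₀) := by
  have hB : 0 < B := hb.trans hbB
  set q := √(b / B) with hq
  have hq0 : 0 < q := by positivity
  -- In the application `b = 2^α` and `B = 2^d`, so this is where `α < d` enters.
  have hq1 : q < 1 := by
    rw [hq, Real.sqrt_lt' one_pos, one_pow, div_lt_one hB]
    exact hbB
  have hpow : ∀ n : ℕ, √(b ^ n) / √(B ^ n) = q ^ n := fun n => by
    rw [← Real.sqrt_div (by positivity), ← div_pow, hq, Real.sqrt_eq_rpow, Real.sqrt_eq_rpow,
      Real.rpow_pow_comm (by positivity)]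
  have hterm : ∀ n, √t / √(B ^ n) * √(b ^ (n + 1)) = √t * √b * q ^ n := fun n => by
    rw [← hpow n, pow_succ, Real.sqrt_mul (by positivity)]
    ring
  have hgeom : ∑ n ∈ Finset.Ico n₀ M, q ^ n ≤ q ^ n₀ / (1 - q) :=
    geom_sum_Ico_le_of_lt_one hq0.le hq1
  have h1q : 0 < 1 - q := by linarith
  calc ∑ n ∈ Finset.Ico n₀ M, √t / √(B ^ n) * √(b ^ (n + 1))
      = √t * √b * ∑ n ∈ Finset.Ico n₀ M, q ^ n := by
        rw [Finset.mul_sum]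
        exact Finset.sum_congr rfl fun n _ => hterm n
    _ ≤ √(B ^ n₀) * √b * (q ^ n₀ / (1 - q)) := by gcongr
    _ = _ := by
        rw [← hpow n₀]
        have : √(B ^ n₀) ≠ 0 := by positivity
        field_simp

/-- On a good environment the local Poisson equation is uniquely solvable, with an energy
bound. -/
theorem exists_localCorrector_of_good (hα : 1 < α) (hd : α < d) (hC : 0 < C) {K : ℝ}
    (hK : 0 ≤ K) :
    ∃ C₄ : ℝ, 0 < C₄ ∧ ∀ (w : Sym2 (Lattice d) → ℝ) (m n₀ : ℕ), BoundedBy w C → n₀ ≤ m + 1 →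
      (m : ℝ) ≤ (2 ^ d) ^ n₀ → (∀ n, n₀ ≤ n → n ≤ m + 1 → PathBound w m n) →
      (∀ n, n₀ ≤ n → n ≤ m + 1 → ∀ x ∈ box d (2 ^ m), ∀ i,
        |∑ u ∈ block m n x, drift α w u i| ≤ K * (√m * √((2 ^ d) ^ n))) →
      ∃ φ : box d (2 ^ m) → EuclideanSpace ℝ (Fin d),
        IsLocalCorrector α w (box d (2 ^ m)) φ ∧
        (∀ ψ : box d (2 ^ m) → EuclideanSpace ℝ (Fin d),
          IsLocalCorrector α w (box d (2 ^ m)) ψ → ψ = φ) ∧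
        localEnergy α w (box d (2 ^ m)) φ ≤ C₄ * ((2 : ℝ) ^ α) ^ n₀ * 2 ^ (m * d) := by
  have hα0 : 0 < α := by linarith
  have hdpos : (0 : ℝ) < d := by linarith
  set b : ℝ := (2 : ℝ) ^ α with hb
  set B : ℝ := (2 : ℝ) ^ d with hB
  have hb0 : 0 < b := by positivity
  have hb1 : 1 ≤ b := Real.one_le_rpow (by norm_num) hα0.le
  have hB0 : 0 < B := by positivity
  have hbB : b < B := by
    rw [hb, hB, ← Real.rpow_natCast]
    exact Real.rpow_lt_rpow_of_exponent_lt (by norm_num) hd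
  set Cp : ℝ := 32 * C * (d : ℝ) ^ ((d : ℝ) + α) with hCp
  have hCp0 : 0 < Cp := by positivity
  set R : ℝ := ∑' z : Lattice d, decay α z with hR
  have hR0 : 0 ≤ R := tsum_nonneg fun z => decay_nonneg α z
  have hq1 : 0 < 1 - √(b / B) := by
    rw [sub_pos, Real.sqrt_lt' one_pos, one_pow, div_lt_one hB0]
    exact hbB
  -- The first summand comes from the deviation at scale `n₀`, the second from the geometric sum
  -- over scales.
  set S₀ : ℝ := C * R * √Cp + 2 * (K * √Cp * (√b / (1 - √(b / B)))) with hS₀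
  have hS₀0 : 0 ≤ S₀ := by positivity
  refine ⟨d * (2 ^ d * (S₀ ^ 2 + 1)), by positivity, ?_⟩
  intro w m n₀ hw hn₀ hm hpath hdrift
  let k : box d (2 ^ m) → box d (2 ^ m) → ℝ := fun x y => kernel α w x y
  have hk : ∀ x y, 0 ≤ k x y := fun x y => kernel_nonneg hα0 hw x y
  have hsymm : ∀ x y, k x y = k y x := fun x y => kernel_symm α w x y
  have hpoin : ∀ f : box d (2 ^ m) → ℝ, ∀ n, n₀ ≤ n → n ≤ m + 1 →
      ∑ x : box d (2 ^ m), ∑ y : box d (2 ^ m) with cell m n y.1 = cell m n x.1,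
        (f x - f y) ^ 2 ≤ ((2 ^ (n * d) : ℕ) : ℝ) * (Cp * b ^ n * dirichlet k f) :=
    fun f n h1 h2 => sum_cell_sq_sub_le hα0 hC hw h2 (hpath n h1 h2) f
  have htop : ∀ x y : box d (2 ^ m), cell m (m + 1) x.1 = cell m (m + 1) y.1 := fun x y => by
    rw [cell_top m x.2, cell_top m y.2]
  -- At scale `m + 1` the only cell is the cube, so the Poincaré inequality controls every
  -- difference.
  have hirr : ∀ f : box d (2 ^ m) → ℝ, dirichlet k f = 0 → ∀ x y, f x = f y := by
    intro f hf x y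
    have h := hpoin f (m + 1) hn₀ le_rfl
    rw [hf, mul_zero, mul_zero] at h
    have hx := (Finset.single_le_sum (fun x _ => Finset.sum_nonneg fun y _ => sq_nonneg _)
      (Finset.mem_univ x)).trans h
    have hxy := (Finset.single_le_sum (fun y _ => sq_nonneg (f x - f y))
      (Finset.mem_filter.mpr ⟨Finset.mem_univ y, htop y x⟩)).trans hx
    exact sub_eq_zero.mp (pow_eq_zero_iff two_ne_zero |>.mp (le_antisymm hxy (sq_nonneg _)))
  have hcardbox := card_box (d := d) m
  have hne : (box d (2 ^ m)).Nonempty := Finset.card_pos.mp (by rw [hcardbox]; positivity)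
  have : Nonempty (box d (2 ^ m)) := hne.to_subtype
  have hsolve := fun i : Fin d =>
    existsUnique_poisson hsymm hirr (sum_neg_drift_add_mean (α := α) (w := w) hne i)
  choose f hf huniq using hsolve
  let φ : box d (2 ^ m) → EuclideanSpace ℝ (Fin d) := fun x => WithLp.toLp 2 fun i => f i x
  have hφ : ∀ x i, φ x i = f i x := fun _ _ => rfl
  refine ⟨φ, (isLocalCorrector_iff φ).mpr fun i => hf i, fun ψ hψ => ?_, ?_⟩
  · funext x
    ext i
    exact congrFun (huniq i (fun x => ψ x i) ((isLocalCorrector_iff ψ).mp hψ i)) x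
  have hcoord : ∀ i, dirichlet k (f i) ≤ 2 ^ d * (S₀ ^ 2 + 1) * b ^ n₀ * 2 ^ (m * d) := by
    intro i
    have henergy : dirichlet k (f i) = ∑ x : box d (2 ^ m), drift α w x i * f i x := by
      rw [dirichlet_eq_neg_sum hsymm]
      simp only [(hf i).1, add_mul, Finset.sum_add_distrib, neg_mul, Finset.sum_neg_distrib]
      rw [← Finset.mul_sum, (hf i).2]
      ring
    have hpowN : ∀ n : ℕ, ((2 ^ (n * d) : ℕ) : ℝ) = B ^ n := fun n => by
      rw [hB, ← pow_mul, mul_comm]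
      push_cast
      rfl
    have hmain := dirichlet_le_of_multiscale (c := fun n (x : box d (2 ^ m)) => cell m n x.1)
      (N := fun n => 2 ^ (n * d)) hn₀ (fun n x hn => card_subtype_block hn x)
      (fun n x y h => cell_succ m n h) htop hk (D := fun n => Cp * b ^ n)
      -- The bound on the cell sum of the drift, divided by the cell volume `B ^ n`.
      (v := fun n => K * (√m / √(B ^ n)))
      (fun n n' h => by
        have := pow_le_pow_right₀ hb1 h
        dsimp only
        gcongr)
      (fun n => by positivity) (fun n => by positivity)
      (fun x => abs_drift_apply_le hα hw x.1 i) (fun n h1 h2 x => by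
        rw [sum_subtype_block m n x fun y => drift α w y i, hpowN]
        refine (hdrift n h1 h2.le x x.2 i).trans (le_of_eq ?_)
        have h : √(B ^ n) ≠ 0 := by positivity
        have h' := Real.mul_self_sqrt (by positivity : 0 ≤ B ^ n)
        field_simp
        rw [Real.sq_sqrt (by positivity)])
      (hpoin (f i)) (hf i).2 henergy
    have hS : C * R * √(Cp * b ^ n₀) + 2 * ∑ n ∈ Finset.Ico n₀ (m + 1),
        K * (√m / √(B ^ n)) * √(Cp * b ^ (n + 1)) ≤ S₀ * √(b ^ n₀) := by
      have hgeo := sum_scale_le hb0 hbB (M := m + 1) hm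
      calc C * R * √(Cp * b ^ n₀) + 2 * ∑ n ∈ Finset.Ico n₀ (m + 1),
            K * (√m / √(B ^ n)) * √(Cp * b ^ (n + 1))
          = C * R * √Cp * √(b ^ n₀) + 2 * (K * √Cp * ∑ n ∈ Finset.Ico n₀ (m + 1),
            √m / √(B ^ n) * √(b ^ (n + 1))) := by
            rw [Real.sqrt_mul hCp0.le, Finset.mul_sum (a := K * √Cp), mul_assoc (C * R)]
            congr 2
            refine Finset.sum_congr rfl fun n _ => ?_
            rw [Real.sqrt_mul hCp0.le]
            ring
        _ ≤ C * R * √Cp * √(b ^ n₀) + 2 * (K * √Cp * (√b / (1 - √(b / B)) * √(b ^ n₀))) := by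
            gcongr
        _ = _ := by rw [hS₀]; ring
    have hS' : 0 ≤ C * R * √(Cp * b ^ n₀) + 2 * ∑ n ∈ Finset.Ico n₀ (m + 1),
        K * (√m / √(B ^ n)) * √(Cp * b ^ (n + 1)) := by positivity
    calc dirichlet k (f i) ≤ _ := hmain
      _ ≤ (Fintype.card (box d (2 ^ m)) : ℝ) * (S₀ * √(b ^ n₀)) ^ 2 := by gcongr
      _ = 2 ^ d * S₀ ^ 2 * b ^ n₀ * 2 ^ (m * d) := by
          rw [Fintype.card_coe, hcardbox, mul_pow, Real.sq_sqrt (by positivity), add_mul, one_mul,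
            pow_add]
          push_cast
          ring
      _ ≤ _ := by
          gcongr
          linarith
  calc localEnergy α w (box d (2 ^ m)) φ = ∑ i, dirichlet k (f i) := localEnergy_eq α w φ
    _ ≤ ∑ _i : Fin d, 2 ^ d * (S₀ ^ 2 + 1) * b ^ n₀ * 2 ^ (m * d) :=
        Finset.sum_le_sum fun i _ => hcoord i
    _ = _ := by
        simp only [Finset.sum_const, Finset.card_univ, Fintype.card_fin, nsmul_eq_mul]
        ring

/-- Positivity for the lexicographic order. -/
def LexPos (z : Lattice d) : Prop := 0 < toLex z

lemma LexPos.not_neg {z : Lattice d} (h : LexPos z) : ¬ LexPos (-z) := by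
  intro h'
  have h1 : 0 < -toLex z := h'
  have h2 : toLex z < 0 := Left.neg_pos_iff.mp h1
  exact lt_asymm (a := (0 : Lex (Lattice d))) h h2

lemma lexPos_or_lexPos_neg {z : Lattice d} (hz : z ≠ 0) : LexPos z ∨ LexPos (-z) := by
  rcases lt_trichotomy (toLex z) 0 with h | h | h
  · right
    have h1 : 0 < -toLex z := Left.neg_pos_iff.mpr h
    exact h1
  · exact absurd h hz
  · exact .inl h

open scoped Classical in
/-- The displacements in `F` that are positive in the lexicographic order. -/
noncomputable def posPart (F : Finset (Lattice d)) : Finset (Lattice d) := F.filter LexPos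

open scoped Classical in
/-- The displacements in `F` that are negative in the lexicographic order. -/
noncomputable def negPart (F : Finset (Lattice d)) : Finset (Lattice d) :=
  F.filter fun z => LexPos (-z)

/-- The condition under which the edges in the centred drift sum are distinct; it is why the
displacements are split by sign. -/
lemma neg_notMem_posPart {F : Finset (Lattice d)} {z : Lattice d} (hz : z ∈ posPart F) :
    -z ∉ posPart F := by
  simp only [posPart, Finset.mem_filter, not_and] at hz ⊢
  exact fun _ => hz.2.not_neg

lemma neg_notMem_negPart {F : Finset (Lattice d)} {z : Lattice d} (hz : z ∈ negPart F) :
    -z ∉ negPart F := by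
  simp only [negPart, Finset.mem_filter, not_and] at hz ⊢
  exact fun _ => hz.2.not_neg

lemma sum_posPart_add_sum_negPart (F : Finset (Lattice d)) {g : Lattice d → ℝ} (hg : g 0 = 0) :
    ∑ z ∈ F, g z = ∑ z ∈ posPart F, g z + ∑ z ∈ negPart F, g z := by
  rw [posPart, negPart, Finset.sum_filter, Finset.sum_filter, ← Finset.sum_add_distrib]
  refine Finset.sum_congr rfl fun z _ => ?_
  rcases eq_or_ne z 0 with rfl | hz
  · simp [hg]
  · by_cases h : LexPos z
    · simp [h, h.not_neg]
    · simp [h, (lexPos_or_lexPos_neg hz).resolve_left h]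

/-- Cell sums of the drift from cell sums of its two centred finite parts. -/
lemma abs_sum_block_drift_le (hα : 1 < α) (hw : BoundedBy w C) {m n : ℕ} (hn : n ≤ m + 1)
    {F : Finset (Lattice d)} {ε : ℝ} (hpos : DriftBound α w m n (posPart F) ε)
    (hneg : DriftBound α w m n (negPart F) ε) {x : Lattice d} (hx : x ∈ box d (2 ^ m))
    (i : Fin d) :
    |∑ u ∈ block m n x, drift α w u i| ≤
      2 * ε + (2 : ℝ) ^ (n * d) * ((C + 1) * ∑' z : {z // z ∉ F}, decay α z.1) := by
  let T : Lattice d → ℝ := fun u => ∑ z ∈ F, driftCoeff α i z * (w s(u, u + z) - 1)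
  have hsplit : ∑ u ∈ block m n x, drift α w u i =
      ∑ u ∈ block m n x, (drift α w u i - T u) +
        (∑ u ∈ block m n x, ∑ z ∈ posPart F, driftCoeff α i z * (w s(u, u + z) - 1) +
          ∑ u ∈ block m n x, ∑ z ∈ negPart F, driftCoeff α i z * (w s(u, u + z) - 1)) := by
    rw [← Finset.sum_add_distrib, ← Finset.sum_add_distrib]
    refine Finset.sum_congr rfl fun u _ => ?_
    rw [← sum_posPart_add_sum_negPart F (g := fun z => driftCoeff α i z * (w s(u, u + z) - 1))
      (by simp [driftCoeff])]
    simp [T]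
  have herr : |∑ u ∈ block m n x, (drift α w u i - T u)| ≤
      (2 : ℝ) ^ (n * d) * ((C + 1) * ∑' z : {z // z ∉ F}, decay α z.1) := by
    refine (Finset.abs_sum_le_sum_abs _ _).trans ((Finset.sum_le_sum fun u _ =>
      abs_drift_sub_sum_le hα hw F u i).trans (le_of_eq ?_))
    rw [Finset.sum_const, card_block hn hx, nsmul_eq_mul]
    push_cast
    rfl
  rw [hsplit]
  refine (abs_add_le _ _).trans ?_
  refine (add_le_add herr ((abs_add_le _ _).trans (add_le_add (hpos x hx i) (hneg x hx i)))).trans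
    (le_of_eq ?_)
  ring

end Deterministic

/-! ### Auxiliary facts on edges and the choice of the starting scale. -/

lemma nonempty_edge {d : ℕ} (hd : 0 < d) : Nonempty (Edge d) := by
  refine ⟨⟨s(0, 1), ?_⟩⟩
  rw [Sym2.mk_isDiag_iff]
  intro h
  have := congrFun h ⟨0, hd⟩
  simp at this

instance countable_edge (d : ℕ) : Countable (Edge d) := by
  have : Countable (Sym2 (Lattice d)) := inferInstanceAs (Countable (Quot _))
  infer_instance

/-- The least admissible exponent overshoots by at most a factor `B`. -/
lemma exists_scale {B A t : ℝ} (hB : 1 < B) (hAt : 1 ≤ A * t) :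
    ∃ n : ℕ, A * t ≤ B ^ n ∧ B ^ n ≤ B * A * t := by
  classical
  have hex := pow_unbounded_of_one_lt (A * t) hB
  have hex' : ∃ n : ℕ, A * t ≤ B ^ n := hex.imp fun n h => h.le
  refine ⟨Nat.find hex', Nat.find_spec hex', ?_⟩
  rcases h : Nat.find hex' with - | n
  · rw [pow_zero, mul_assoc]
    nlinarith
  · have hlt : B ^ n < A * t := not_le.mp (Nat.find_min hex' (m := n) (by omega))
    rw [pow_succ', mul_assoc]
    exact mul_le_mul_of_nonneg_left hlt.le (by linarith)

/-! ### Summable bad events and the final assembly. -/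

section Assembly

variable {Ω : Type*} {d : ℕ}
  {w : Sym2 (Lattice d) → Ω → ℝ} {C α : ℝ}

lemma ae_boundedBy [MeasurableSpace Ω] {P : Measure Ω}
    (hb : ∀ e : Edge d, ∀ᵐ ω ∂P, w e ω ∈ Set.Icc 0 C) :
    ∀ᵐ ω ∂P, BoundedBy (fun e => w e ω) C := by
  filter_upwards [ae_all_iff.mpr hb] with ω h x y hxy
  exact h ⟨s(x, y), by simpa using hxy⟩

/-- The environments for which the path bounds or the drift bounds fail at some scale between
`n₀` and that of the cube `(-2^m, 2^m]^d`. -/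
def badEvent (α : ℝ) (w : Sym2 (Lattice d) → Ω → ℝ) (K : ℝ) (m n₀ : ℕ) (F : Finset (Lattice d)) :
    Set Ω :=
  ⋃ n ∈ Finset.Icc n₀ (m + 1), ({ω | ¬ PathBound (fun e => w e ω) m n} ∪
    ({ω | ¬ DriftBound α (fun e => w e ω) m n (posPart F) (K * (√m * √((2 ^ d) ^ n)))} ∪
      {ω | ¬ DriftBound α (fun e => w e ω) m n (negPart F) (K * (√m * √((2 ^ d) ^ n)))}))

/-- The constants are chosen so that each single failure has probability at most `exp (-4dm)`, up to
a factor two. In the scale condition, `16 * d * C ^ 4` does this for the paths and `4` gives each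
cell at least four points; the drift threshold does it for the drift. The union bounds cost at most
the square of the volume, below `exp (2d(m+1))`, and there are at most `m + 2` scales. -/
lemma measureReal_badEvent_le [MeasurableSpace Ω] {P : Measure Ω} [IsProbabilityMeasure P]
    [Nonempty (Edge d)] (hd : 0 < d) (hα : 1 < α)
    (hw : IIDConductances P w)
    (hC : 0 < C) (hb : ∀ e : Edge d, ∀ᵐ ω ∂P, w e ω ∈ Set.Icc 0 C) {m n₀ : ℕ} (hm : 1 ≤ m)
    (hn₀ : (4 + 16 * d * C ^ 4) * m ≤ ((2 : ℝ) ^ d) ^ n₀) (F : Finset (Lattice d)) :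
    P.real (badEvent α w (2 * d * (∑' z : Lattice d, decay α z + 1) * C) m n₀ F) ≤
      (4 * d + 1) * Real.exp (2 * d) * ((m + 2) * Real.exp (-m)) := by
  set R : ℝ := ∑' z : Lattice d, decay α z with hR
  have hR0 : 0 ≤ R := tsum_nonneg fun z => decay_nonneg α z
  have hm' : (1 : ℝ) ≤ m := by exact_mod_cast hm
  have hd' : (1 : ℝ) ≤ d := by exact_mod_cast hd
  set G : ℝ := (2 : ℝ) ^ ((m + 1) * d) with hG
  have hG1 : 1 ≤ G := one_le_pow₀ (by norm_num)
  set η : ℝ := Real.exp (-(4 * d * m)) with hη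
  have hη0 : 0 < η := Real.exp_pos _
  have hscale : ∀ n, n₀ ≤ n → (4 + 16 * d * C ^ 4) * m ≤ (2 : ℝ) ^ (n * d) := fun n hn => by
    rw [mul_comm n d, pow_mul]
    exact hn₀.trans (pow_le_pow_right₀ (one_le_pow₀ (by norm_num)) hn)
  have hpath : ∀ n ∈ Finset.Icc n₀ (m + 1),
      P.real {ω | ¬ PathBound (fun e => w e ω) m n} ≤ G * (G * η) := by
    intro n hn
    obtain ⟨h1, h2⟩ := Finset.mem_Icc.mp hn
    have hs := hscale n h1
    have hCm : 0 ≤ 16 * d * C ^ 4 * m := by positivity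
    have h4 : (4 : ℝ) ≤ 2 ^ (n * d) := by nlinarith
    refine (measureReal_not_pathBound_le hw hC hb h2 (by exact_mod_cast h4)).trans ?_
    gcongr
    rw [hη, Real.exp_le_exp, div_le_iff₀ (by positivity)]
    nlinarith
  have hdrift : ∀ n ∈ Finset.Icc n₀ (m + 1), ∀ F' : Finset (Lattice d), (∀ z ∈ F', -z ∉ F') →
      P.real {ω | ¬ DriftBound α (fun e => w e ω) m n F'
        (2 * d * (R + 1) * C * (√m * √((2 ^ d) ^ n)))} ≤ G * (d * (2 * η)) := by
    intro n hn F' hF'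
    obtain ⟨h1, h2⟩ := Finset.mem_Icc.mp hn
    refine (measureReal_not_driftBound_le hα hw hb h2 hF' (by positivity)).trans ?_
    gcongr
    rw [mul_pow, mul_pow (√(m : ℝ)), Real.sq_sqrt (by positivity), Real.sq_sqrt (by positivity),
      ← pow_mul, mul_comm d n, hη, Real.exp_le_exp,
      div_le_iff₀ (by positivity)]
    have : 0 ≤ ((d : ℝ) - 1) * (4 * d * m * (2 ^ (n * d) * (R + 1) ^ 2 * C ^ 2)) :=
      mul_nonneg (by linarith) (by positivity)
    nlinarith
  have hGexp : G ≤ Real.exp ((m + 1) * d) := by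
    have h2 : (2 : ℝ) ≤ Real.exp 1 := by
      have := Real.add_one_le_exp 1
      linarith
    calc G ≤ Real.exp 1 ^ ((m + 1) * d) := by rw [hG]; gcongr
      _ = _ := by
          rw [← Real.exp_nat_mul]
          push_cast
          ring_nf
  calc P.real (badEvent α w (2 * d * (R + 1) * C) m n₀ F)
      ≤ ∑ n ∈ Finset.Icc n₀ (m + 1), P.real ({ω | ¬ PathBound (fun e => w e ω) m n} ∪
          ({ω | ¬ DriftBound α (fun e => w e ω) m n (posPart F)
            (2 * d * (R + 1) * C * (√m * √((2 ^ d) ^ n)))} ∪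
          {ω | ¬ DriftBound α (fun e => w e ω) m n (negPart F)
            (2 * d * (R + 1) * C * (√m * √((2 ^ d) ^ n)))})) :=
        measureReal_biUnion_finset_le _ _
    _ ≤ ∑ n ∈ Finset.Icc n₀ (m + 1), (G * (G * η) + (G * (d * (2 * η)) + G * (d * (2 * η)))) :=
        Finset.sum_le_sum fun n hn => (measureReal_union_le _ _).trans <|
          add_le_add (hpath n hn) <| (measureReal_union_le _ _).trans <| add_le_add
            (hdrift n hn _ fun z => neg_notMem_posPart)
            (hdrift n hn _ fun z => neg_notMem_negPart)
    _ = (m + 1 + 1 - n₀ : ℕ) * (G * (G * η) + (G * (d * (2 * η)) + G * (d * (2 * η)))) := by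
        rw [Finset.sum_const, Nat.card_Icc, nsmul_eq_mul]
    _ ≤ (m + 2) * (G ^ 2 * (4 * d + 1) * η) := by
        have h1 : ((m + 1 + 1 - n₀ : ℕ) : ℝ) ≤ m + 2 := by
          have : m + 1 + 1 - n₀ ≤ m + 2 := by omega
          exact_mod_cast this
        refine mul_le_mul h1 ?_ (by positivity) (by positivity)
        have : 0 ≤ (G - 1) * (G * (4 * d * η)) := mul_nonneg (by linarith) (by positivity)
        nlinarith
    _ ≤ (m + 2) * (Real.exp ((m + 1) * d) ^ 2 * (4 * d + 1) * η) := by gcongr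
    _ = (m + 2) * ((4 * d + 1) * (Real.exp (2 * d) * Real.exp (-(2 * d * m)))) := by
        rw [← Real.exp_add, ← Real.exp_nat_mul, mul_comm (Real.exp _) (4 * (d : ℝ) + 1), mul_assoc,
          hη, ← Real.exp_add]
        congr 3
        push_cast
        ring
    _ ≤ (m + 2) * ((4 * d + 1) * (Real.exp (2 * d) * Real.exp (-m))) := by
        gcongr
        nlinarith
    _ = _ := by ring

lemma summable_linear_mul_exp_neg : Summable fun m : ℕ => ((m : ℝ) + 2) * Real.exp (-m) := by
  have h1 := Real.summable_pow_mul_exp_neg_nat_mul 1 one_pos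
  have h0 := Real.summable_pow_mul_exp_neg_nat_mul 0 one_pos
  refine (h1.add (h0.mul_left 2)).congr fun m => ?_
  simp
  ring

/-- Outside the bad event the local corrector exists, is unique and has bounded energy. -/
lemma exists_good_constant (hα : 1 < α) (hd : α < d) (hC : 0 < C) {K : ℝ} (hK : 0 ≤ K) :
    ∃ C₄ : ℝ, 0 < C₄ ∧ ∀ (w : Sym2 (Lattice d) → Ω → ℝ) (ω : Ω) (m n₀ : ℕ)
      (F : Finset (Lattice d)), BoundedBy (fun e => w e ω) C → 1 ≤ m → n₀ ≤ m + 1 →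
      (m : ℝ) ≤ (2 ^ d) ^ n₀ →
      ∑' z : {z // z ∉ F}, decay α z.1 ≤ ((C + 1) * 2 ^ ((m + 1) * d))⁻¹ →
      ω ∉ badEvent α w K m n₀ F →
      ∃ φ : box d (2 ^ m) → EuclideanSpace ℝ (Fin d),
        IsLocalCorrector α (fun e => w e ω) (box d (2 ^ m)) φ ∧
        (∀ ψ : box d (2 ^ m) → EuclideanSpace ℝ (Fin d),
          IsLocalCorrector α (fun e => w e ω) (box d (2 ^ m)) ψ → ψ = φ) ∧
        localEnergy α (fun e => w e ω) (box d (2 ^ m)) φ ≤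
          C₄ * ((2 : ℝ) ^ α) ^ n₀ * 2 ^ (m * d) := by
  -- `2 * K` covers the positive and negative displacements; the extra `1` absorbs the truncation
  -- error, at most one per cell.
  obtain ⟨C₄, hC₄, h⟩ := exists_localCorrector_of_good hα hd hC (K := 2 * K + 1) (by positivity)
  refine ⟨C₄, hC₄, fun w ω m n₀ F hw hm hn₀ hmn hF hω => ?_⟩
  have hgood : ∀ n, n₀ ≤ n → n ≤ m + 1 → PathBound (fun e => w e ω) m n ∧
      DriftBound α (fun e => w e ω) m n (posPart F) (K * (√m * √((2 ^ d) ^ n))) ∧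
      DriftBound α (fun e => w e ω) m n (negPart F) (K * (√m * √((2 ^ d) ^ n))) := by
    intro n h1 h2
    by_contra hcon
    refine hω (Set.mem_biUnion (Finset.mem_coe.mpr (Finset.mem_Icc.mpr ⟨h1, h2⟩)) ?_)
    simp only [Set.mem_union, Set.mem_ofPred_eq]
    tauto
  refine h _ m n₀ hw hn₀ hmn (fun n h1 h2 => (hgood n h1 h2).1) fun n h1 h2 x hx i => ?_
  refine (abs_sum_block_drift_le hα hw h2 (hgood n h1 h2).2.1 (hgood n h1 h2).2.2 hx i).trans ?_
  have hm' : (1 : ℝ) ≤ m := by exact_mod_cast hm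
  have herr : (2 : ℝ) ^ (n * d) * ((C + 1) * ∑' z : {z // z ∉ F}, decay α z.1) ≤ 1 := by
    calc (2 : ℝ) ^ (n * d) * ((C + 1) * ∑' z : {z // z ∉ F}, decay α z.1)
        ≤ 2 ^ ((m + 1) * d) * ((C + 1) * ((C + 1) * 2 ^ ((m + 1) * d))⁻¹) := by
          gcongr
          · exact mul_nonneg (by positivity) (tsum_nonneg fun z => decay_nonneg α z.1)
          · norm_num
      _ = 1 := by field_simp
  have hone : (1 : ℝ) ≤ √m * √((2 ^ d) ^ n) := by
    have h1 : (1 : ℝ) ≤ √m := Real.one_le_sqrt.mpr hm'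
    have h2 : (1 : ℝ) ≤ √((2 ^ d) ^ n) :=
      Real.one_le_sqrt.mpr (one_le_pow₀ (one_le_pow₀ (by norm_num)))
    nlinarith
  linarith

/-- The power of the scale in terms of the logarithmic volume. -/
lemma rpow_pow_le_of_pow_le {d n : ℕ} {α t : ℝ} (hd : 0 < d) (hα : 0 ≤ α)
    (h : ((2 : ℝ) ^ d) ^ n ≤ t) : ((2 : ℝ) ^ α) ^ n ≤ t ^ (α / d) := by
  have hd' : (d : ℝ) ≠ 0 := by positivity
  calc ((2 : ℝ) ^ α) ^ n = (((2 : ℝ) ^ d) ^ n) ^ (α / d) := by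
        rw [← Real.rpow_natCast (2 : ℝ) d, ← Real.rpow_natCast, ← Real.rpow_natCast,
          ← Real.rpow_mul (by norm_num), ← Real.rpow_mul (by norm_num),
          ← Real.rpow_mul (by norm_num)]
        congr 1
        field_simp
    _ ≤ _ := by gcongr

end Assembly

end StableConductance

theorem proposition3p1 {Ω : Type*} [MeasurableSpace Ω] (P : Measure Ω) [IsProbabilityMeasure P]
    (d : ℕ) (α : ℝ) (hα₁ : 1 < α) (hα₂ : α < 2) (hd : α < (d : ℝ))
    (w : Sym2 (StableConductance.Lattice d) → Ω → ℝ)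
    (hw : StableConductance.IIDConductances P w)
    (γ : ℝ) (hγ : 0 < γ) :
    ∃ C₃ : ℝ, 0 < C₃ ∧ ∃ m₁ : Ω → ℕ, Measurable m₁ ∧ (∀ ω, 1 ≤ m₁ ω) ∧
      ∀ᵐ ω ∂P, ∀ m : ℕ, m₁ ω < m →
        ∃ φ : StableConductance.box d (2 ^ m) → EuclideanSpace ℝ (Fin d),
          StableConductance.IsLocalCorrector α (fun e => w e ω)
            (StableConductance.box d (2 ^ m)) φ ∧
          (∀ ψ : StableConductance.box d (2 ^ m) → EuclideanSpace ℝ (Fin d),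
            StableConductance.IsLocalCorrector α (fun e => w e ω)
              (StableConductance.box d (2 ^ m)) ψ → ψ = φ) ∧
          StableConductance.localEnergy α (fun e => w e ω)
              (StableConductance.box d (2 ^ m)) φ ≤
            C₃ * (m : ℝ) ^ ((1 + γ) * α / min (2 * ((d : ℝ) - α)) (d : ℝ)) *
              (2 : ℝ) ^ (m * d) := by

  have hα0 : 0 < α := by linarith
  have hdpos : 0 < d := by
    have : (0 : ℝ) < d := by linarith
    exact_mod_cast this
  have hd1 : (1 : ℝ) ≤ d := by exact_mod_cast hdpos
  have := StableConductance.nonempty_edge hdpos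
  obtain ⟨C, hC, hbound⟩ := hw.bounded
  have hb : ∀ e : StableConductance.Edge d, ∀ᵐ ω ∂P, w e ω ∈ Set.Icc 0 C := fun e => by
    filter_upwards [hw.nonneg e, hbound e] with ω h1 h2 using ⟨h1, h2⟩
  set R : ℝ := ∑' z : StableConductance.Lattice d, StableConductance.decay α z with hR
  have hR0 : 0 ≤ R := tsum_nonneg fun z => StableConductance.decay_nonneg α z
  set A : ℝ := 4 + 16 * d * C ^ 4 with hA
  have hA4 : 4 ≤ A := by
    have : 0 ≤ 16 * d * C ^ 4 := by positivity
    linarith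
  obtain ⟨C₄, hC₄, hgood⟩ := StableConductance.exists_good_constant (Ω := Ω) hα₁ hd hC
    (K := 2 * d * (R + 1) * C) (by positivity)
  have hB1 : (1 : ℝ) < 2 ^ d := one_lt_pow₀ (by norm_num) hdpos.ne'
  have hscale : ∀ m : ℕ, ∃ n : ℕ, 1 ≤ m →
      A * m ≤ ((2 : ℝ) ^ d) ^ n ∧ ((2 : ℝ) ^ d) ^ n ≤ 2 ^ d * A * m := by
    intro m
    by_cases hm : 1 ≤ m
    · have hm' : (1 : ℝ) ≤ m := by exact_mod_cast hm
      obtain ⟨n, hn⟩ := StableConductance.exists_scale hB1 (A := A) (t := m) (by nlinarith)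
      exact ⟨n, fun _ => hn⟩
    · exact ⟨0, fun h => absurd h hm⟩
  choose n₀ hn₀ using hscale
  -- The tail is small enough that even summed over the whole cube the truncation error is at most
  -- one.
  choose F hF using fun m : ℕ => StableConductance.exists_finset_tail_le (d := d) α
    (δ := ((C + 1) * 2 ^ ((m + 1) * d))⁻¹) (by positivity)
  have hsummable : Summable fun m : ℕ => P.real
      (StableConductance.badEvent α w (2 * d * (R + 1) * C) m (n₀ m) (F m)) := by
    have h := StableConductance.summable_linear_mul_exp_neg.mul_left
      ((4 * d + 1) * Real.exp (2 * d))
    -- The bound on the bad event needs `1 ≤ m`; the shift discards `m = 0`.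
    rw [← summable_nat_add_iff 1] at h ⊢
    refine Summable.of_nonneg_of_le (fun m => measureReal_nonneg) (fun m => ?_) h
    exact StableConductance.measureReal_badEvent_le hdpos hα₁ hw hC hb (Nat.le_add_left 1 m)
      (hn₀ (m + 1) (Nat.le_add_left 1 m)).1 (F (m + 1))
  obtain ⟨m₁, hm₁, hm₁ge, hae⟩ :=
    StableConductance.exists_measurable_index hsummable (⌈2 ^ d * A⌉₊ + 1)
  refine ⟨C₄ * (2 ^ d * A) ^ (α / d), by positivity, m₁, hm₁,
    fun ω => (Nat.le_add_left 1 _).trans (hm₁ge ω), ?_⟩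
  filter_upwards [hae, StableConductance.ae_boundedBy hb] with ω hω hbω m hm
  have hmge : ⌈2 ^ d * A⌉₊ + 1 < m := (hm₁ge ω).trans_lt hm
  have hm1 : 1 ≤ m := by omega
  have hm1' : (1 : ℝ) ≤ m := by exact_mod_cast hm1
  obtain ⟨hlow, hup⟩ := hn₀ m hm1
  -- The threshold `⌈2 ^ d * A⌉₊ + 1` gives `2^(d n₀) ≤ 2^d A m ≤ m² ≤ 4^m ≤ 2^(dm)`, the last step
  -- by `d ≥ 2`.
  have hnm : n₀ m ≤ m + 1 := by
    have hAm : 2 ^ d * A ≤ m := (Nat.le_ceil _).trans (Nat.cast_le.mpr (by omega))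
    have h2m : (m : ℝ) ≤ 2 ^ m := by exact_mod_cast (Nat.lt_two_pow_self (n := m)).le
    have hd2 : 2 ≤ d := by
      have : (1 : ℝ) < d := hα₁.trans hd
      exact_mod_cast this
    have h4 : ((2 : ℝ) ^ d) ^ n₀ m ≤ ((2 : ℝ) ^ d) ^ m := by
      calc ((2 : ℝ) ^ d) ^ n₀ m ≤ 2 ^ d * A * m := hup
        _ ≤ 2 ^ m * 2 ^ m := by
            gcongr
            exact hAm.trans h2m
        _ = (2 ^ 2) ^ m := by rw [← mul_pow]; norm_num
        _ ≤ _ := by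
            gcongr
            norm_num
    exact ((pow_le_pow_iff_right₀ hB1).mp h4).trans (Nat.le_succ m)
  obtain ⟨φ, hφ, huniq, henergy⟩ := hgood w ω m (n₀ m) (F m) hbω hm1 hnm
    (by nlinarith) (hF m) (hω m hm)
  refine ⟨φ, hφ, huniq, henergy.trans ?_⟩
  have hpow := StableConductance.rpow_pow_le_of_pow_le hdpos hα0.le hup
  rw [Real.mul_rpow (by positivity) (by positivity)] at hpow
  -- The proof yields the exponent `α / d`; the stated one has a larger numerator and a denominator
  -- of at most `d`.
  have hexp : α / d ≤ (1 + γ) * α / min (2 * ((d : ℝ) - α)) d := by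
    have hmin : 0 < min (2 * ((d : ℝ) - α)) d := lt_min (by linarith) (by linarith)
    have h1 : α ≤ (1 + γ) * α := by nlinarith
    exact div_le_div₀ (by positivity) h1 hmin (min_le_right _ _)
  calc C₄ * ((2 : ℝ) ^ α) ^ n₀ m * 2 ^ (m * d)
      ≤ C₄ * ((2 ^ d * A) ^ (α / d) * (m : ℝ) ^ (α / d)) * 2 ^ (m * d) := by gcongr
    _ ≤ C₄ * ((2 ^ d * A) ^ (α / d) *
          (m : ℝ) ^ ((1 + γ) * α / min (2 * ((d : ℝ) - α)) (d : ℝ))) * 2 ^ (m * d) := by gcongr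
    _ = _ := by ring
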